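/- **Theorem 4.4 (Main negative result for sparse regression).** For integers $0\le k\le p$ let $\mathcal X_{p,k}=\{v\in\{0,1\}^p:\|v\|_0=k\}$, and let $G_{p,k}$ be the Johnson graph on $\mathcal X_{p,k}$, in which two vectors are adjacent iff they differ in exactly two entries (their supports share exactly $k-1$ elements). For $n\ge 1$ and $\sigma^2>0$ let $X\in\mathbb R^{n\times p}$ have i.i.d. $N(0,1)$ entries, let $W\sim N(0,\sigma^2 I_n)$, let $v^*$ be uniform on $\mathcal X_{p,k}$, with $X,W,v^*$ independent, and let $Y=Xv^*+W$. For $\beta>0$ let $\pi_\beta$ be the (random) probability distribution on $\mathcal X_{p,k}$ with $\pi_\beta(v)\propto\exp(-\beta\|Y-Xv\|_2^2)$. There are constants $c,C,\kappa>0$ such that the following holds. Let $\eta>0$ and let $k=k_i$, $n=n_i$, $p=p_i$, $\sigma^2=\sigma_i^2$, $\beta=\beta_i$ be sequences with $k_i\to\infty$ as $i\to\infty$, with $k\le p$, $n\ge1$, $\sigma^2>0$ for every $i$, and such that $$n\le c\,k\log(p/k),\qquad \sigma^2\le k,\qquad k=o\big(p^{1/3-\eta}\big),\qquad \beta> C\,\frac{\log(p/k)}{n}\exp\Big(\frac{2k\log(p/k)}{n}\Big).$$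 Then, with probability tending to $1$ as $i\to\infty$ over $(X,W,v^*)$, every reversible Markov chain on $G_{p,k}$ with stationary distribution $\pi_\beta$ has mixing time at least $\exp(\kappa\,k\log(p/k))$. Here a reversible Markov chain on $G_{p,k}$ with stationary distribution $\pi_\beta$ is a stochastic matrix $P$ on $\mathcal X_{p,k}$ with $P(x,y)=0$ whenever $x\ne y$ are not adjacent and $\pi_\beta(x)P(x,y)=\pi_\beta(y)P(y,x)$ for all $x,y$; its mixing time is $\min\{t\ge 0:\max_x\|P^t(x,\cdot)-\pi_\beta\|_{\mathrm{TV}}\le 1/4\}$, and $\infty$ if there is no such $t$. -/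

import Mathlib

open MeasureTheory ProbabilityTheory Filter Asymptotics
open scoped ENNReal NNReal Topology Matrix

noncomputable section

namespace SparseRegression

/-- The set of `p`-dimensional binary vectors with exactly `k` ones, each vector being identified
with its support, a `k`-subset of `{1, …, p}`. -/
abbrev SparseVec (p k : ℕ) : Type := {S : Finset (Fin p) // S.card = k}

/-- The binary vector in `ℝ^p` whose support is `v`. -/
def SparseVec.toVec {p k : ℕ} (v : SparseVec p k) : Fin p → ℝ :=
  fun j => if j ∈ v.1 then 1 else 0

/-- The Johnson graph `G_{p,k}`: two `k`-subsets are adjacent iff they share exactly `k - 1`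
elements (equivalently, the two binary vectors differ in exactly two entries). -/
def johnsonGraph (p k : ℕ) : SimpleGraph (SparseVec p k) where
  Adj v w := (v.1 ∩ w.1).card + 1 = k
  symm := ⟨fun v w h => by rwa [Finset.inter_comm] at h⟩
  loopless := ⟨fun v h => by
    have := v.2
    rw [Finset.inter_self] at h
    omega⟩

/-- The random data `(X, W, v*)`: the covariates `X` have i.i.d. standard Gaussian entries, the
noise `W` is `N(0, σ² I_n)`, the hidden vector `v*` is uniform, and the three are independent. -/
def dataLaw (n p k : ℕ) (σsq : ℝ≥0) :
    Measure ((Fin n → Fin p → ℝ) × (Fin n → ℝ) × SparseVec p k) :=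
  (Measure.pi fun _ => Measure.pi fun _ => gaussianReal 0 1).prod
    ((Measure.pi fun _ => gaussianReal 0 σsq).prod (uniformOn Set.univ))

/-- The observations `Y = X v* + W`. -/
def response {n p k : ℕ} (X : Fin n → Fin p → ℝ) (W : Fin n → ℝ) (vstar : SparseVec p k) :
    Fin n → ℝ :=
  Matrix.of X *ᵥ vstar.toVec + W

/-- The Hamiltonian `H(v) = -‖Y - X v‖₂²`. -/
def hamiltonian {n p k : ℕ} (X : Fin n → Fin p → ℝ) (Y : Fin n → ℝ) (v : SparseVec p k) : ℝ :=
  -∑ i, (Y i - (Matrix.of X *ᵥ v.toVec) i) ^ 2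

/-- The probability vector on a finite set proportional to `exp (β H)`. -/
def gibbs {V : Type*} [Fintype V] (β : ℝ) (H : V → ℝ) (v : V) : ℝ :=
  Real.exp (β * H v) / ∑ w, Real.exp (β * H w)

/-- `P` is the transition matrix of a Markov chain on the graph `G` (every step stays put or moves
to a neighbour) that is reversible with respect to `π` (detailed balance; in particular, when `π`
is a probability vector, `π` is a stationary distribution of the chain). -/
structure IsReversibleChain {V : Type*} [Fintype V] [DecidableEq V] (G : SimpleGraph V)
    (π : V → ℝ) (P : Matrix V V ℝ) : Prop where
  stochastic : P ∈ Matrix.rowStochastic ℝ V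
  is_local : ∀ x y, x ≠ y → ¬ G.Adj x y → P x y = 0
  detailed_balance : ∀ x y, π x * P x y = π y * P y x

/-- Total variation distance of two probability vectors on a finite set. -/
def tvDist {V : Type*} [Fintype V] (μ ν : V → ℝ) : ℝ :=
  (1 / 2) * ∑ x, |μ x - ν x|

/-- The mixing time: the least `t` such that, from every initial state, the law of the chain after
`t` steps is within total variation distance `1/4` of `π` (it is `⊤` if there is no such `t`). -/
def mixingTime {V : Type*} [Fintype V] [DecidableEq V] (P : Matrix V V ℝ) (π : V → ℝ) : ℕ∞ :=
  ⨅ t ∈ {t : ℕ | ∀ x, tvDist ((P ^ t) x) π ≤ 1 / 4}, (t : ℕ∞)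

/-- The event that every reversible Markov chain on the Johnson graph with stationary distribution
`π_β` has mixing time at least `T`. -/
def allChainsSlow (n p k : ℕ) (β T : ℝ) :
    Set ((Fin n → Fin p → ℝ) × (Fin n → ℝ) × SparseVec p k) :=
  {d | ∀ P : Matrix (SparseVec p k) (SparseVec p k) ℝ,
    IsReversibleChain (johnsonGraph p k)
      (gibbs β (hamiltonian d.1 (response d.1 d.2.1 d.2.2))) P →
    ENNReal.ofReal T ≤
      (mixingTime P (gibbs β (hamiltonian d.1 (response d.1 d.2.1 d.2.2))) : ℝ≥0∞)}

end SparseRegression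

end

/-!
Low-energy supports of the sparse regression Hamiltonian are isolated from each other, and there are
several of them far apart; the chain cannot travel between them. Write `L = log (p / k)` and let
`radius n p k = √k · exp (100 - k L / n)`, so that the expected number
of supports `v` with energy `‖Y - X v‖²` at most `n · radius ^ 2` is `exp (O(k + n))`. At the inverse
temperatures considered, `β · n · radius ^ 2` is a large multiple of `k L`, which exceeds the
entropy `log (p.choose k)`.

*Existence.* Split the columns outside the hidden support into two halves. They are independent of
`Y`. Conditionally on a `Y` of typical length, the number of supports `v` in one half for which every
coordinate of `X v` is within `radius` of `Y` has an exponentially large mean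
(`Regime.le_expected`), and Chebyshev's inequality applies (`real_forall_notMem_matBox_le`). Pairs
of supports with small overlap are controlled by comparing the bivariate Gaussian density with the
product of its marginals (`gaussianPDFReal_mul_mul_le`, `Regime.far_term_le`), and pairs with large
overlap by the small ball probability of `X v - X w`, or by their small number if the overlap is
almost full (`Regime.near_term_le`). So each half contains a low-energy support.

*Isolation.* A first moment count over pairs shows that no low-energy support `v₀` outside the hidden
one has another support of comparable energy at distance `k / 2`
(`Regime.matGauss_exists_pair_le`): the two events force `Y - X v₀` and `X v - X v₀` to be short,
and these are small ball events for two disjoint blocks of columns of `v₀`. No property of `v` other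
than its distance to `v₀` is used, so overlaps of `v` with the hidden support do no harm.

*Bottleneck.* Hence the supports at distance at most `k / 2` from `v₀` and their complement both
contain a state of energy at most `n · radius ^ 2`, while the shell at distance `k / 2`, which every
path on the Johnson graph from one to the other has to cross, has energy at least
`4 n · radius ^ 2`. For a reversible chain the mixing time is at least the mass of the smaller side
over four times the mass of the shell (`IsReversibleChain.le_mixingTime`).
-/

noncomputable section

namespace SparseRegression

/-! ### Mixing times and bottlenecks -/

section Mixing

variable {V : Type*} [Fintype V] [DecidableEq V] {G : SimpleGraph V} {π : V → ℝ}
  {P : Matrix V V ℝ}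

lemma IsReversibleChain.sum_mul_eq (hP : IsReversibleChain G π P) (y : V) :
    ∑ x, π x * P x y = π y := by
  simp_rw [hP.detailed_balance _ y]
  rw [← Finset.mul_sum, Matrix.sum_row_of_mem_rowStochastic hP.stochastic, mul_one]

lemma IsReversibleChain.sum_mul_pow_eq (hP : IsReversibleChain G π P) (t : ℕ) (y : V) :
    ∑ x, π x * (P ^ t) x y = π y := by
  induction t generalizing y with
  | zero => simp [Matrix.one_apply]
  | succ t ih =>
    simp_rw [pow_succ, Matrix.mul_apply, Finset.mul_sum, ← mul_assoc]
    rw [Finset.sum_comm]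
    simp_rw [← Finset.sum_mul, ih]
    exact hP.sum_mul_eq y

/-- A stationary reversible chain started in `S` is outside `S` at time `t` with probability at
most `t` times the one-step flow out of `S`. -/
lemma IsReversibleChain.escape_le (hP : IsReversibleChain G π P) (hπ : ∀ x, 0 ≤ π x)
    (S : Finset V) (t : ℕ) :
    ∑ x ∈ S, ∑ y ∈ Sᶜ, π x * (P ^ t) x y ≤ t * ∑ x ∈ S, ∑ y ∈ Sᶜ, π x * P x y := by
  have hpow : ∀ t, P ^ t ∈ Matrix.rowStochastic ℝ V := fun t => pow_mem hP.stochastic t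
  have hnn : ∀ t x y, 0 ≤ (P ^ t) x y := fun t x y =>
    Matrix.nonneg_of_mem_rowStochastic (hpow t)
  have hnn1 : ∀ x y, 0 ≤ P x y := fun x y => Matrix.nonneg_of_mem_rowStochastic hP.stochastic
  have hrow : ∀ z, ∑ y ∈ Sᶜ, P z y ≤ 1 := fun z => by
    rw [← Matrix.sum_row_of_mem_rowStochastic hP.stochastic z]
    exact Finset.sum_le_sum_of_subset_of_nonneg (Finset.subset_univ _) fun y _ _ => hnn1 z y
  induction t with
  | zero =>
    have : ∑ x ∈ S, ∑ y ∈ Sᶜ, π x * (P ^ 0) x y = 0 := by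
      refine Finset.sum_eq_zero fun x hx => Finset.sum_eq_zero fun y hy => ?_
      have hxy : x ≠ y := by
        rintro rfl
        simp_all
      simp [hxy]
    rw [this]
    simp
  | succ t ih =>
    have h1 : ∑ x ∈ S, ∑ y ∈ Sᶜ, π x * (P ^ (t + 1)) x y
        = ∑ z, (∑ x ∈ S, π x * (P ^ t) x z) * ∑ y ∈ Sᶜ, P z y := by
      simp_rw [pow_succ, Matrix.mul_apply, Finset.mul_sum, Finset.sum_mul]
      rw [Finset.sum_congr rfl fun x _ => Finset.sum_comm]
      rw [Finset.sum_comm]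
      refine Finset.sum_congr rfl fun z _ => ?_
      rw [Finset.sum_comm]
      refine Finset.sum_congr rfl fun y _ => Finset.sum_congr rfl fun x _ => by ring
    have hin : ∀ z, 0 ≤ ∑ x ∈ S, π x * (P ^ t) x z := fun z =>
      Finset.sum_nonneg fun x _ => mul_nonneg (hπ x) (hnn t x z)
    have hle : ∀ z, ∑ x ∈ S, π x * (P ^ t) x z ≤ π z := fun z => by
      rw [← hP.sum_mul_pow_eq t z]
      exact Finset.sum_le_sum_of_subset_of_nonneg (Finset.subset_univ _) fun x _ _ =>
        mul_nonneg (hπ x) (hnn t x z)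
    rw [h1, ← Finset.sum_add_sum_compl S]
    have h2 : ∑ z ∈ S, (∑ x ∈ S, π x * (P ^ t) x z) * ∑ y ∈ Sᶜ, P z y
        ≤ ∑ x ∈ S, ∑ y ∈ Sᶜ, π x * P x y := by
      refine Finset.sum_le_sum fun z _ => ?_
      rw [← Finset.mul_sum]
      exact mul_le_mul_of_nonneg_right (hle z) (Finset.sum_nonneg fun y _ => hnn1 z y)
    have h3 : ∑ z ∈ Sᶜ, (∑ x ∈ S, π x * (P ^ t) x z) * ∑ y ∈ Sᶜ, P z y
        ≤ ∑ x ∈ S, ∑ y ∈ Sᶜ, π x * (P ^ t) x y := by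
      rw [Finset.sum_comm (s := S)]
      exact Finset.sum_le_sum fun z _ => mul_le_of_le_one_right (hin z) (hrow z)
    push_cast
    linarith

lemma tvDist_ge_sum_sub (μ ν : V → ℝ) (h : ∑ x, μ x = ∑ x, ν x) (S : Finset V) :
    ∑ x ∈ S, (ν x - μ x) ≤ tvDist μ ν := by
  have h1 : ∑ x ∈ S, (ν x - μ x) = ∑ x ∈ Sᶜ, (μ x - ν x) := by
    have h2 := Finset.sum_add_sum_compl S fun x => ν x - μ x
    have h3 : ∑ x, (ν x - μ x) = 0 := by rw [Finset.sum_sub_distrib, h, sub_self]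
    have h4 : ∑ x ∈ Sᶜ, (μ x - ν x) = - ∑ x ∈ Sᶜ, (ν x - μ x) := by
      rw [← Finset.sum_neg_distrib]
      exact Finset.sum_congr rfl fun x _ => by ring
    linarith
  have h2 : ∑ x ∈ S, (ν x - μ x) ≤ ∑ x ∈ S, |μ x - ν x| :=
    Finset.sum_le_sum fun x _ => by rw [abs_sub_comm]; exact le_abs_self _
  have h3 : ∑ x ∈ Sᶜ, (μ x - ν x) ≤ ∑ x ∈ Sᶜ, |μ x - ν x| :=
    Finset.sum_le_sum fun x _ => le_abs_self _
  have h4 := Finset.sum_add_sum_compl S fun x => |μ x - ν x|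
  unfold tvDist
  linarith

/-- A chain that is close to stationarity at time `t` from every start must have had time to leave
any set of mass at most `1/2`. -/
lemma IsReversibleChain.mass_le_of_tvDist_le (hP : IsReversibleChain G π P)
    (hπ : ∀ x, 0 ≤ π x) (hsum : ∑ x, π x = 1) (S : Finset V) (hS : ∑ x ∈ S, π x ≤ 1 / 2) (t : ℕ)
    (ht : ∀ x, tvDist ((P ^ t) x) π ≤ 1 / 4) :
    ∑ x ∈ S, π x ≤ 4 * t * ∑ x ∈ S, ∑ y ∈ Sᶜ, π x * P x y := by
  have hpow : P ^ t ∈ Matrix.rowStochastic ℝ V := pow_mem hP.stochastic t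
  have h1 : ∀ x, 1 / 4 ≤ ∑ y ∈ Sᶜ, (P ^ t) x y := fun x => by
    have h2 := tvDist_ge_sum_sub ((P ^ t) x) π
      (by rw [hsum, Matrix.sum_row_of_mem_rowStochastic hpow]) Sᶜ
    rw [Finset.sum_sub_distrib] at h2
    have h3 := Finset.sum_add_sum_compl S π
    have := ht x
    linarith
  have h2 : ∑ x ∈ S, π x * (1 / 4) ≤ ∑ x ∈ S, ∑ y ∈ Sᶜ, π x * (P ^ t) x y := by
    refine Finset.sum_le_sum fun x _ => ?_
    rw [← Finset.mul_sum]
    exact mul_le_mul_of_nonneg_left (h1 x) (hπ x)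
  have h3 := hP.escape_le hπ S t
  rw [← Finset.sum_mul] at h2
  linarith

/-- Bottleneck bound: if every transition out of `S` starts in `D`, the mixing time is at least
`min (π S) (π Sᶜ) / (4 π D)`. -/
lemma IsReversibleChain.le_mixingTime (hP : IsReversibleChain G π P)
    (hπ : ∀ x, 0 ≤ π x) (hsum : ∑ x, π x = 1) (S D : Finset V)
    (hD : ∀ x ∈ S, ∀ y ∉ S, G.Adj x y → x ∈ D) {T a : ℝ} (ha : 0 < a)
    (h1 : a ≤ ∑ x ∈ S, π x) (h2 : a ≤ ∑ x ∈ Sᶜ, π x) (hT : 4 * T * ∑ x ∈ D, π x ≤ a) :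
    ENNReal.ofReal T ≤ (mixingTime P π : ℝ≥0∞) := by
  have hnn1 : ∀ x y, 0 ≤ P x y := fun x y => Matrix.nonneg_of_mem_rowStochastic hP.stochastic
  have hflow : ∑ x ∈ S, ∑ y ∈ Sᶜ, π x * P x y ≤ ∑ x ∈ D, π x := by
    have h3 : ∀ x ∈ S, ∑ y ∈ Sᶜ, π x * P x y ≤ if x ∈ D then π x else 0 := fun x hx => by
      split_ifs with hxD
      · rw [← Finset.mul_sum]
        refine mul_le_of_le_one_right (hπ x) ?_
        rw [← Matrix.sum_row_of_mem_rowStochastic hP.stochastic x]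
        exact Finset.sum_le_sum_of_subset_of_nonneg (Finset.subset_univ _) fun y _ _ => hnn1 x y
      · refine (Finset.sum_eq_zero fun y hy => ?_).le
        have hy' : y ∉ S := by simpa using hy
        rw [hP.is_local x y (by rintro rfl; exact hy' hx) fun h => hxD (hD x hx y hy' h), mul_zero]
    refine (Finset.sum_le_sum h3).trans ?_
    rw [← Finset.sum_filter]
    refine Finset.sum_le_sum_of_subset_of_nonneg (fun x hx => (Finset.mem_filter.1 hx).2)
      fun x _ _ => hπ x
  have hrev : ∑ x ∈ Sᶜ, ∑ y ∈ Sᶜᶜ, π x * P x y = ∑ x ∈ S, ∑ y ∈ Sᶜ, π x * P x y := by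
    rw [compl_compl, Finset.sum_comm]
    exact Finset.sum_congr rfl fun x _ => Finset.sum_congr rfl fun y _ => hP.detailed_balance y x
  have key : ∀ t : ℕ, (∀ x, tvDist ((P ^ t) x) π ≤ 1 / 4) → T ≤ t := fun t ht => by
    have h3 : a ≤ 4 * t * ∑ x ∈ D, π x := by
      have h4 := Finset.sum_add_sum_compl S π
      rcases le_total (∑ x ∈ S, π x) (1 / 2) with h | h
      · refine (h1.trans (hP.mass_le_of_tvDist_le hπ hsum S h t ht)).trans ?_
        gcongr
      · refine (h2.trans (hP.mass_le_of_tvDist_le hπ hsum Sᶜ (by linarith) t ht)).trans ?_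
        rw [hrev]
        gcongr
    have h5 : 0 < ∑ x ∈ D, π x := by
      by_contra h
      have : ∑ x ∈ D, π x = 0 := le_antisymm (not_lt.1 h) (Finset.sum_nonneg fun x _ => hπ x)
      rw [this] at h3
      linarith
    by_contra h
    push Not at h
    nlinarith [mul_lt_mul_of_pos_right h h5]
  have h6 : (⌈T⌉₊ : ℕ∞) ≤ mixingTime P π := by
    unfold mixingTime
    refine le_iInf₂ fun t ht => ?_
    exact_mod_cast Nat.ceil_le.2 (key t ht)
  calc ENNReal.ofReal T ≤ ENNReal.ofReal (⌈T⌉₊ : ℝ) := ENNReal.ofReal_le_ofReal (Nat.le_ceil T)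
    _ = ((⌈T⌉₊ : ℕ∞) : ℝ≥0∞) := by simp
    _ ≤ _ := by exact_mod_cast h6

end Mixing

lemma gibbs_nonneg {V : Type*} [Fintype V] (β : ℝ) (H : V → ℝ) (v : V) : 0 ≤ gibbs β H v := by
  unfold gibbs
  positivity

lemma sum_gibbs {V : Type*} [Fintype V] [Nonempty V] (β : ℝ) (H : V → ℝ) :
    ∑ v, gibbs β H v = 1 := by
  unfold gibbs
  rw [← Finset.sum_div]
  exact div_self (Finset.sum_pos (fun v _ => Real.exp_pos _) Finset.univ_nonempty).ne'

lemma card_sparseVec (p k : ℕ) : Fintype.card (SparseVec p k) = p.choose k := by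
  rw [Fintype.card_finset_len, Fintype.card_fin]

/-- Two far apart low-energy states, one of which is surrounded by a shell of high-energy states,
slow down every reversible chain on the Johnson graph. -/
lemma mem_allChainsSlow_of_shell {n p k : ℕ} {β T E₀ E₁ : ℝ} (hβ : 0 ≤ β) (m : ℕ)
    (d : (Fin n → Fin p → ℝ) × (Fin n → ℝ) × SparseVec p k) (v₀ v₁ : SparseVec p k)
    (h₀ : -E₀ ≤ hamiltonian d.1 (response d.1 d.2.1 d.2.2) v₀)
    (h₁ : -E₀ ≤ hamiltonian d.1 (response d.1 d.2.1 d.2.2) v₁)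
    (hfar : m < (v₀.1 \ v₁.1).card)
    (hshell : ∀ v : SparseVec p k, (v₀.1 \ v.1).card = m →
      hamiltonian d.1 (response d.1 d.2.1 d.2.2) v ≤ -E₁)
    (hT : 4 * T * p.choose k ≤ Real.exp (β * (E₁ - E₀))) (hT0 : 0 ≤ T) :
    d ∈ allChainsSlow n p k β T := by
  intro P hP
  set H := hamiltonian d.1 (response d.1 d.2.1 d.2.2) with hH
  have : Nonempty (SparseVec p k) := ⟨v₀⟩
  set Z := ∑ w, Real.exp (β * H w) with hZ
  have hZ0 : 0 < Z := Finset.sum_pos (fun v _ => Real.exp_pos _) Finset.univ_nonempty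
  have hlow : ∀ v, -E₀ ≤ H v → Real.exp (-(β * E₀)) / Z ≤ gibbs β H v := fun v hv => by
    unfold gibbs
    gcongr
    nlinarith
  refine hP.le_mixingTime (gibbs_nonneg β H) (sum_gibbs β H)
    (Finset.univ.filter fun v => (v₀.1 \ v.1).card ≤ m)
    (Finset.univ.filter fun v => (v₀.1 \ v.1).card = m) ?_
    (a := Real.exp (-(β * E₀)) / Z) (by positivity) ?_ ?_ ?_
  · intro x hx y hy hxy
    simp only [Finset.mem_filter, Finset.mem_univ, true_and, not_le] at hx hy ⊢
    change (x.1 ∩ y.1).card + 1 = k at hxy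
    have h2 : (x.1 \ y.1).card = 1 := by
      have := Finset.card_inter_add_card_sdiff x.1 y.1
      have := x.2
      omega
    have h3 : v₀.1 \ y.1 ⊆ (v₀.1 \ x.1) ∪ (x.1 \ y.1) := by
      intro j
      simp only [Finset.mem_sdiff, Finset.mem_union]
      tauto
    have := (Finset.card_le_card h3).trans (Finset.card_union_le _ _)
    omega
  · refine (hlow v₀ h₀).trans (Finset.single_le_sum (fun v _ => gibbs_nonneg β H v) ?_)
    simp
  · refine (hlow v₁ h₁).trans (Finset.single_le_sum (fun v _ => gibbs_nonneg β H v) ?_)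
    simpa using hfar
  · have h4 : ∑ v ∈ Finset.univ.filter (fun v : SparseVec p k => (v₀.1 \ v.1).card = m),
        gibbs β H v ≤ p.choose k * (Real.exp (-(β * E₁)) / Z) := by
      have h5 : ∀ v ∈ Finset.univ.filter (fun v : SparseVec p k => (v₀.1 \ v.1).card = m),
          gibbs β H v ≤ Real.exp (-(β * E₁)) / Z := fun v hv => by
        have := hshell v (Finset.mem_filter.1 hv).2
        unfold gibbs
        gcongr
        nlinarith
      refine (Finset.sum_le_card_nsmul _ _ _ h5).trans ?_
      rw [nsmul_eq_mul]
      gcongr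
      rw [← card_sparseVec]
      exact Finset.card_le_univ _
    calc 4 * T * ∑ v ∈ Finset.univ.filter (fun v : SparseVec p k => (v₀.1 \ v.1).card = m),
          gibbs β H v ≤ 4 * T * (p.choose k * (Real.exp (-(β * E₁)) / Z)) := by gcongr
      _ = (4 * T * p.choose k) * (Real.exp (-(β * E₁)) / Z) := by ring
      _ ≤ Real.exp (β * (E₁ - E₀)) * (Real.exp (-(β * E₁)) / Z) := by gcongr
      _ = Real.exp (-(β * E₀)) / Z := by
        rw [← mul_div_assoc, ← Real.exp_add]
        congr 2
        ring

/-! ### Resampling coordinates of product measures -/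

section Resample

variable {ι : Type*} [Fintype ι] [DecidableEq ι]

/-- Replacing the coordinates in `S` of a sample of a product probability measure by those of an
independent copy does not change the law. -/
lemma measurePreserving_piecewise {α : Type*} [MeasurableSpace α] (μ : ι → Measure α)
    [∀ i, IsProbabilityMeasure (μ i)] (S : Finset ι) :
    MeasurePreserving (fun z : (ι → α) × (ι → α) => S.piecewise z.2 z.1)
      ((Measure.pi μ).prod (Measure.pi μ)) (Measure.pi μ) := by
  have hm : Measurable (fun z : (ι → α) × (ι → α) => S.piecewise z.2 z.1) := by
    refine measurable_pi_lambda _ fun i => ?_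
    by_cases hi : i ∈ S
    · simp only [Finset.piecewise, hi, if_true]; fun_prop
    · simp only [Finset.piecewise, hi, if_false]; fun_prop
  refine ⟨hm, (Measure.pi_eq fun s hs => ?_).symm⟩
  rw [Measure.map_apply hm (MeasurableSet.univ_pi hs)]
  have : (fun z : (ι → α) × (ι → α) => S.piecewise z.2 z.1) ⁻¹' Set.univ.pi s
      = (Set.univ.pi fun i => if i ∈ S then Set.univ else s i) ×ˢ
        (Set.univ.pi fun i => if i ∈ S then s i else Set.univ) := by
    ext z
    simp only [Set.mem_preimage, Set.mem_univ_pi, Set.mem_prod]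
    rw [← forall_and]
    refine forall_congr' fun i => ?_
    by_cases hi : i ∈ S <;> simp [Finset.piecewise, hi]
  rw [this, Measure.prod_prod, Measure.pi_pi, Measure.pi_pi, ← Finset.prod_mul_distrib]
  refine Finset.prod_congr rfl fun i _ => ?_
  by_cases hi : i ∈ S <;> simp [hi]

/-- The matrix version of `measurePreserving_piecewise`: resampling the columns in `S`. -/
lemma measurePreserving_piecewise_matrix {κ : Type*} [Fintype κ] (μ : ι → Measure ℝ)
    [∀ i, IsProbabilityMeasure (μ i)] (S : Finset ι) :
    MeasurePreserving (fun z : (κ → ι → ℝ) × (κ → ι → ℝ) => fun i => S.piecewise (z.2 i) (z.1 i))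
      ((Measure.pi fun _ => Measure.pi μ).prod (Measure.pi fun _ => Measure.pi μ))
      (Measure.pi fun _ => Measure.pi μ) := by
  have h1 := measurePreserving_arrowProdEquivProdArrow (ι → ℝ) (ι → ℝ) κ
    (fun _ => Measure.pi μ) (fun _ => Measure.pi μ)
  have h2 := measurePreserving_pi (fun _ : κ => (Measure.pi μ).prod (Measure.pi μ))
    (fun _ : κ => Measure.pi μ) (fun _ => measurePreserving_piecewise μ S)
  exact h2.comp (h1.symm _)

/-- The standard Gaussian measure on `ℝ^ι`. -/
abbrev stdGauss (ι : Type*) [Fintype ι] : Measure (ι → ℝ) :=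
  Measure.pi fun _ => gaussianReal 0 1

lemma map_sum_stdGauss (T : Finset ι) :
    (stdGauss ι).map (fun x => ∑ j ∈ T, x j) = gaussianReal 0 (T.card : ℝ≥0) := by
  induction T using Finset.induction_on with
  | empty => simp [Measure.map_const]
  | insert i T hi ih =>
    have hind : iIndepFun (fun (i : ι) (x : ι → ℝ) => x i) (stdGauss ι) :=
      iIndepFun_pi (X := fun _ => id) fun _ => aemeasurable_id
    have h1 := (hind.indepFun_finsetSum_of_notMem (fun i => measurable_pi_apply i) hi).symm
    have h2 : (stdGauss ι).map (fun x => x i) = gaussianReal 0 1 :=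
      (measurePreserving_eval (fun _ : ι => gaussianReal 0 1) i).map_eq
    have h3 : (∑ j ∈ T, fun x : ι → ℝ => x j) = fun x => ∑ j ∈ T, x j := by
      ext x; simp
    rw [h3] at h1
    have h4 := gaussianReal_add_gaussianReal_of_indepFun h1 h2 ih
    rw [Finset.card_insert_of_notMem hi]
    have h5 : (fun x : ι → ℝ => ∑ j ∈ insert i T, x j)
        = (fun x => x i) + fun x => ∑ j ∈ T, x j := by
      ext x; simp [Finset.sum_insert hi]
    rw [h5, h4]
    congr 1
    · simp
    · push_cast; ring

lemma lintegral_sum_stdGauss (T : Finset ι) {F : ℝ → ℝ≥0∞} (hF : Measurable F) :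
    ∫⁻ x, F (∑ j ∈ T, x j) ∂stdGauss ι = ∫⁻ a, F a ∂gaussianReal 0 (T.card : ℝ≥0) := by
  rw [← map_sum_stdGauss T, lintegral_map hF (by fun_prop)]

/-- Integrating out the block sum `∑ j ∈ T, x j` of a standard Gaussian vector, conditionally on
the coordinates outside `T`. -/
lemma lintegral_block_stdGauss (T : Finset ι) (F : ℝ → (ι → ℝ) → ℝ≥0∞)
    (hF : Measurable (Function.uncurry F)) (hT : ∀ a x x', F a (T.piecewise x' x) = F a x) :
    ∫⁻ x, F (∑ j ∈ T, x j) x ∂stdGauss ι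
      = ∫⁻ x, ∫⁻ a, F a x ∂gaussianReal 0 (T.card : ℝ≥0) ∂stdGauss ι := by
  have hmp := measurePreserving_piecewise (fun _ : ι => gaussianReal 0 1) T
  have hG : Measurable fun x : ι → ℝ => F (∑ j ∈ T, x j) x :=
    hF.comp (by fun_prop : Measurable fun x : ι → ℝ => (∑ j ∈ T, x j, x))
  rw [← hmp.lintegral_comp hG, lintegral_prod _ (by
    exact (hG.comp hmp.measurable).aemeasurable)]
  refine lintegral_congr fun x => ?_
  have h1 : ∀ x', ∑ j ∈ T, T.piecewise x' x j = ∑ j ∈ T, x' j := fun x' =>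
    Finset.sum_congr rfl fun j hj => by simp [hj]
  simp only [hT, h1]
  exact lintegral_sum_stdGauss T (F := fun a => F a x)
    (hF.comp (by fun_prop : Measurable fun a : ℝ => (a, x)))

end Resample

/-! ### Gaussian estimates on the line -/

lemma gaussianReal_Icc_le (a : ℝ) {v : ℝ≥0} (hv : v ≠ 0) (u w : ℝ) :
    gaussianReal a v (Set.Icc u w) ≤ ENNReal.ofReal ((w - u) / √(2 * Real.pi * v)) := by
  rw [gaussianReal_apply a hv]
  calc ∫⁻ x in Set.Icc u w, gaussianPDF a v x
      ≤ ∫⁻ x in Set.Icc u w, ENNReal.ofReal (√(2 * Real.pi * v))⁻¹ := by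
        refine lintegral_mono fun x => ENNReal.ofReal_le_ofReal ?_
        rw [gaussianPDFReal_def]
        refine mul_le_of_le_one_right (by positivity) (Real.exp_le_one_iff.2 ?_)
        rw [neg_div, neg_nonpos]
        positivity
    _ = _ := by
        rw [setLIntegral_const, Real.volume_Icc, ← ENNReal.ofReal_mul (by positivity)]
        congr 1
        ring

lemma le_gaussianReal_Icc {v : ℝ≥0} (hv : v ≠ 0) (y δ : ℝ) :
    ENNReal.ofReal (2 * δ / √(2 * Real.pi * v) * Real.exp (-(|y| + δ) ^ 2 / (2 * v)))
      ≤ gaussianReal 0 v (Set.Icc (y - δ) (y + δ)) := by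
  rw [gaussianReal_apply 0 hv]
  calc _ = ∫⁻ x in Set.Icc (y - δ) (y + δ),
        ENNReal.ofReal ((√(2 * Real.pi * v))⁻¹ * Real.exp (-(|y| + δ) ^ 2 / (2 * v))) := by
        rw [setLIntegral_const, Real.volume_Icc, ← ENNReal.ofReal_mul (by positivity)]
        congr 1
        ring
    _ ≤ _ := by
        refine setLIntegral_mono' measurableSet_Icc fun x hx => ENNReal.ofReal_le_ofReal ?_
        rw [gaussianPDFReal_def]
        have h1 : |x| ≤ |y| + δ := by
          rw [abs_le]
          have := abs_le.1 (le_refl |y|)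
          constructor <;> linarith [hx.1, hx.2]
        have h2 : (x - 0) ^ 2 ≤ (|y| + δ) ^ 2 := by
          rw [sub_zero, ← sq_abs x]
          exact pow_le_pow_left₀ (abs_nonneg x) h1 2
        refine mul_le_mul_of_nonneg_left (Real.exp_le_exp.2 ?_) (by positivity)
        rw [neg_div, neg_div, neg_le_neg_iff]
        gcongr

/-- The product of the centred Gaussian density at `a` with two Gaussian densities centred at `a`,
compared with the two marginal densities: this is Mehler's formula together with
`2 * x * x' ≤ x ^ 2 + x' ^ 2`. -/
lemma gaussianPDFReal_mul_mul_le {l m : ℝ≥0} (hl : l ≠ 0) (hm : m ≠ 0) {x x' R : ℝ}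
    (hx : |x| ≤ R) (hx' : |x'| ≤ R) (a : ℝ) :
    gaussianPDFReal 0 l a * (gaussianPDFReal a m x * gaussianPDFReal a m x') ≤
      ((l + m) / √(m * (m + 2 * l)) * Real.exp (l * R ^ 2 / (l + m) ^ 2)) *
        (gaussianPDFReal (l * (x + x') / (m + 2 * l)) (l * m / (m + 2 * l)) a *
          (gaussianPDFReal 0 (l + m) x * gaussianPDFReal 0 (l + m) x')) := by
  simp only [gaussianPDFReal_def]
  have hl' : (0 : ℝ) < l := by positivity
  have hm' : (0 : ℝ) < m := by positivity
  push_cast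
  generalize (l : ℝ) = l at *
  generalize (m : ℝ) = m at *
  have hπ := Real.pi_pos
  have hxR : x ^ 2 ≤ R ^ 2 := by rw [← sq_abs x]; gcongr
  have hxR' : x' ^ 2 ≤ R ^ 2 := by rw [← sq_abs x']; gcongr
  have hc : (√(2 * Real.pi * l))⁻¹ * ((√(2 * Real.pi * m))⁻¹ * (√(2 * Real.pi * m))⁻¹)
      = (l + m) / √(m * (m + 2 * l)) * ((√(2 * Real.pi * (l * m / (m + 2 * l))))⁻¹ *
        ((√(2 * Real.pi * (l + m)))⁻¹ * (√(2 * Real.pi * (l + m)))⁻¹)) := by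
    rw [← mul_inv, ← mul_inv, ← mul_inv, ← mul_inv, Real.mul_self_sqrt (by positivity),
      Real.mul_self_sqrt (by positivity)]
    have h1 : √(2 * Real.pi * l) = √(m * (m + 2 * l)) * √(2 * Real.pi * (l * m / (m + 2 * l))) / m := by
      rw [← Real.sqrt_mul (by positivity), eq_div_iff hm'.ne']
      nth_rewrite 1 [← Real.sqrt_sq hm'.le]
      rw [← Real.sqrt_mul (by positivity)]
      congr 1
      field_simp
    rw [h1]
    field_simp
  have he : Real.exp (-(a - 0) ^ 2 / (2 * l)) * (Real.exp (-(x - a) ^ 2 / (2 * m)) *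
        Real.exp (-(x' - a) ^ 2 / (2 * m))) ≤
      Real.exp (l * R ^ 2 / (l + m) ^ 2) *
        (Real.exp (-(a - l * (x + x') / (m + 2 * l)) ^ 2 / (2 * (l * m / (m + 2 * l)))) *
        (Real.exp (-(x - 0) ^ 2 / (2 * (l + m))) * Real.exp (-(x' - 0) ^ 2 / (2 * (l + m))))) := by
    rw [← Real.exp_add, ← Real.exp_add, ← Real.exp_add, ← Real.exp_add, ← Real.exp_add]
    refine Real.exp_le_exp.2 ?_
    have h1 : l * (x ^ 2 + x' ^ 2) / (2 * (l + m) ^ 2) ≤ l * R ^ 2 / (l + m) ^ 2 := by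
      rw [div_le_div_iff₀ (by positivity) (by positivity)]
      nlinarith [mul_le_mul_of_nonneg_left hxR (by positivity : 0 ≤ l * (l + m) ^ 2),
        mul_le_mul_of_nonneg_left hxR' (by positivity : 0 ≤ l * (l + m) ^ 2)]
    have h2 : l * (x ^ 2 + x' ^ 2) / (2 * (l + m) ^ 2) + (-(a - l * (x + x') / (m + 2 * l)) ^ 2 /
        (2 * (l * m / (m + 2 * l))) + (-(x - 0) ^ 2 / (2 * (l + m)) +
        -(x' - 0) ^ 2 / (2 * (l + m)))) - (-(a - 0) ^ 2 / (2 * l) +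
        (-(x - a) ^ 2 / (2 * m) + -(x' - a) ^ 2 / (2 * m)))
        = l * (x - x') ^ 2 / (2 * m * (m + 2 * l)) +
          l ^ 2 * (x ^ 2 + x' ^ 2) * (-1) * 0 + (x ^ 2 + x' ^ 2) / 2 *
          (1 / (m + 2 * l) - 1 / (l + m) + l / (l + m) ^ 2) := by
      field_simp
      ring
    have h3 : 0 ≤ 1 / (m + 2 * l) - 1 / (l + m) + l / (l + m) ^ 2 := by
      have : 1 / (m + 2 * l) - 1 / (l + m) + l / (l + m) ^ 2
          = l ^ 2 / ((m + 2 * l) * (l + m) ^ 2) := by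
        field_simp
        ring
      rw [this]
      positivity
    have h4 : 0 ≤ l * (x - x') ^ 2 / (2 * m * (m + 2 * l)) := by positivity
    have h5 := mul_nonneg (by positivity : 0 ≤ (x ^ 2 + x' ^ 2) / 2) h3
    linarith
  calc _ = ((√(2 * Real.pi * l))⁻¹ * ((√(2 * Real.pi * m))⁻¹ * (√(2 * Real.pi * m))⁻¹)) *
        (Real.exp (-(a - 0) ^ 2 / (2 * l)) * (Real.exp (-(x - a) ^ 2 / (2 * m)) *
        Real.exp (-(x' - a) ^ 2 / (2 * m)))) := by ring
    _ ≤ ((√(2 * Real.pi * l))⁻¹ * ((√(2 * Real.pi * m))⁻¹ * (√(2 * Real.pi * m))⁻¹)) * _ :=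
        mul_le_mul_of_nonneg_left he (by positivity)
    _ = _ := by
        rw [hc]
        ring

lemma lintegral_gaussianReal {v : ℝ≥0} (hv : v ≠ 0) (μ : ℝ) {f : ℝ → ℝ≥0∞} (hf : Measurable f) :
    ∫⁻ x, f x ∂gaussianReal μ v = ∫⁻ x, gaussianPDF μ v x * f x := by
  rw [gaussianReal_of_var_ne_zero μ hv,
    lintegral_withDensity_eq_lintegral_mul _ (measurable_gaussianPDF μ v) hf]
  rfl

lemma gaussianReal_preimage_const_add (v : ℝ≥0) (a : ℝ) {I : Set ℝ} (hI : MeasurableSet I) :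
    gaussianReal 0 v {b | a + b ∈ I} = gaussianReal a v I := by
  have h := gaussianReal_map_const_add (μ := 0) (v := v) a
  rw [zero_add] at h
  rw [← h, Measure.map_apply (by fun_prop) hI]
  rfl

lemma lintegral_mul_sq_swap {f : ℝ → ℝ≥0∞} {g : ℝ → ℝ → ℝ≥0∞} (hf : Measurable f)
    (hg : Measurable fun z : ℝ × ℝ => g z.1 z.2) (I : Set ℝ) :
    ∫⁻ a, f a * (∫⁻ x in I, g a x) ^ 2
      = ∫⁻ x in I, ∫⁻ x' in I, ∫⁻ a, f a * (g a x * g a x') := by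
  have hga : ∀ a, Measurable (g a) := fun a => hg.comp (by fun_prop : Measurable fun x => (a, x))
  have hmeas : Measurable fun z : (ℝ × ℝ) × ℝ => f z.1.1 * (g z.1.1 z.1.2 * g z.1.1 z.2) :=
    (hf.comp (by fun_prop : Measurable fun z : (ℝ × ℝ) × ℝ => z.1.1)).mul
      ((hg.comp (by fun_prop : Measurable fun z : (ℝ × ℝ) × ℝ => (z.1.1, z.1.2))).mul
        (hg.comp (by fun_prop : Measurable fun z : (ℝ × ℝ) × ℝ => (z.1.1, z.2))))
  calc _ = ∫⁻ a, ∫⁻ x in I, ∫⁻ x' in I, f a * (g a x * g a x') := by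
        refine lintegral_congr fun a => ?_
        simp_rw [fun x => lintegral_const_mul (μ := volume.restrict I) (f a)
          (((hga a).const_mul (g a x)) : Measurable fun x' => g a x * g a x'),
          fun x => lintegral_const_mul (μ := volume.restrict I) (g a x) (hga a)]
        rw [lintegral_const_mul _ ((hga a).mul_const _), lintegral_mul_const _ (hga a), sq]
    _ = _ := by
        rw [lintegral_lintegral_swap]
        · refine lintegral_congr fun x => ?_
          rw [lintegral_lintegral_swap]
          exact (hmeas.comp
            (by fun_prop : Measurable fun z : ℝ × ℝ => ((z.1, x), z.2))).aemeasurable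
        · exact (hmeas.lintegral_prod_right' (ν := volume.restrict I)).aemeasurable

/-- Two Gaussian variables with variance `l + m` and covariance `l`: the probability that both are
within `δ` of `y`, compared with the square of the probability of one of these events. -/
lemma lintegral_sq_gaussianReal_le {l m : ℝ≥0} (hl : l ≠ 0) (hm : m ≠ 0) (y δ : ℝ) :
    ∫⁻ a, (gaussianReal a m (Set.Icc (y - δ) (y + δ))) ^ 2 ∂gaussianReal 0 l ≤
      ENNReal.ofReal ((l + m) / √(m * (m + 2 * l)) *
        Real.exp (l * (|y| + δ) ^ 2 / (l + m) ^ 2)) *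
      (gaussianReal 0 (l + m) (Set.Icc (y - δ) (y + δ))) ^ 2 := by
  set I := Set.Icc (y - δ) (y + δ) with hI
  set R := |y| + δ with hR
  set C := (l + m) / √(m * (m + 2 * l)) * Real.exp (l * R ^ 2 / (l + m) ^ 2) with hC
  have hlm : l + m ≠ 0 := by positivity
  have hxR : ∀ x ∈ I, |x| ≤ R := fun x hx => by
    rw [abs_le]
    have := abs_le.1 (le_refl |y|)
    constructor <;> linarith [hx.1, hx.2]
  have hpdf : ∀ (v : ℝ≥0), Measurable fun z : ℝ × ℝ => gaussianPDF z.1 v z.2 := fun v =>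
    measurable_uncurry_gaussianPDF.comp
      (by fun_prop : Measurable fun z : ℝ × ℝ => (z.1, v, z.2))
  have hsq : ∀ (a : ℝ) (v : ℝ≥0), v ≠ 0 → (gaussianReal a v I) ^ 2
      = ∫⁻ x in I, ∫⁻ x' in I, gaussianPDF a v x * gaussianPDF a v x' := fun a v hv => by
    rw [gaussianReal_apply a hv, sq]
    simp_rw [lintegral_const_mul _ (measurable_gaussianPDF a v)]
    rw [lintegral_mul_const _ (measurable_gaussianPDF a v)]
  have hτ : l * m / (m + 2 * l) ≠ 0 := by positivity
  have hin : ∀ x ∈ I, ∀ x' ∈ I,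
      ∫⁻ a, gaussianPDF 0 l a * (gaussianPDF a m x * gaussianPDF a m x') ≤
        ENNReal.ofReal C * (gaussianPDF 0 (l + m) x * gaussianPDF 0 (l + m) x') := by
    intro x hx x' hx'
    calc _ ≤ ∫⁻ a, gaussianPDF (l * (x + x') / (m + 2 * l)) (l * m / (m + 2 * l)) a *
          (ENNReal.ofReal C * (gaussianPDF 0 (l + m) x * gaussianPDF 0 (l + m) x')) := by
          refine lintegral_mono fun a => ?_
          simp only [gaussianPDF]
          rw [← ENNReal.ofReal_mul (gaussianPDFReal_nonneg _ _ _),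
            ← ENNReal.ofReal_mul (gaussianPDFReal_nonneg _ _ _),
            ← ENNReal.ofReal_mul (gaussianPDFReal_nonneg _ _ _),
            ← ENNReal.ofReal_mul (by positivity),
            ← ENNReal.ofReal_mul (gaussianPDFReal_nonneg _ _ _)]
          refine ENNReal.ofReal_le_ofReal ?_
          refine (gaussianPDFReal_mul_mul_le hl hm (hxR x hx) (hxR x' hx') a).trans (le_of_eq ?_)
          ring
      _ = _ := by
          rw [lintegral_mul_const _ (measurable_gaussianPDF _ _), lintegral_gaussianPDF_eq_one _ hτ,
            one_mul]
  have hmq : Measurable fun a => (gaussianReal a m I) ^ 2 := by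
    simp_rw [fun a => gaussianReal_apply a hm I]
    exact ((hpdf m).lintegral_prod_right' (ν := volume.restrict I)).pow_const 2
  calc _ = ∫⁻ a, gaussianPDF 0 l a * (∫⁻ x in I, gaussianPDF a m x) ^ 2 := by
        rw [lintegral_gaussianReal hl 0 hmq]
        simp_rw [fun a => gaussianReal_apply a hm I]
    _ = ∫⁻ x in I, ∫⁻ x' in I, ∫⁻ a,
        gaussianPDF 0 l a * (gaussianPDF a m x * gaussianPDF a m x') :=
        lintegral_mul_sq_swap (measurable_gaussianPDF 0 l) (hpdf m) I
    _ ≤ ∫⁻ x in I, ∫⁻ x' in I,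
        ENNReal.ofReal C * (gaussianPDF 0 (l + m) x * gaussianPDF 0 (l + m) x') := by
        refine setLIntegral_mono' measurableSet_Icc fun x hx => ?_
        exact setLIntegral_mono' measurableSet_Icc fun x' hx' => hin x hx x' hx'
    _ = _ := by
        rw [hsq 0 (l + m) hlm, ← lintegral_const_mul]
        · refine lintegral_congr fun x => ?_
          rw [lintegral_const_mul _ ((measurable_gaussianPDF _ _).const_mul _)]
        · simp_rw [lintegral_const_mul _ (measurable_gaussianPDF 0 (l + m))]
          exact (measurable_gaussianPDF _ _).mul_const _

lemma lintegral_exp_neg_sq_gaussianReal_le {v : ℝ≥0} (hv : v ≠ 0) {s : ℝ} (hs : 0 < s) (y : ℝ) :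
    ∫⁻ a, ENNReal.ofReal (Real.exp (-(s / 2) * (a - y) ^ 2)) ∂gaussianReal 0 v ≤
      ENNReal.ofReal (1 / √(s * v)) := by
  rw [lintegral_gaussianReal hv 0 (by fun_prop)]
  have hs' : s.toNNReal⁻¹ ≠ 0 := by
    simpa using hs
  have hv' : (0 : ℝ) < v := by positivity
  have hπ := Real.pi_pos
  calc _ ≤ ∫⁻ a, ENNReal.ofReal (1 / √(s * v)) * gaussianPDF y s.toNNReal⁻¹ a := by
        refine lintegral_mono fun a => ?_
        simp only [gaussianPDF]
        rw [← ENNReal.ofReal_mul (gaussianPDFReal_nonneg _ _ _),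
          ← ENNReal.ofReal_mul (by positivity)]
        refine ENNReal.ofReal_le_ofReal ?_
        rw [gaussianPDFReal_def, gaussianPDFReal_def]
        have h1 : Real.exp (-(a - 0) ^ 2 / (2 * v)) ≤ 1 := by
          refine Real.exp_le_one_iff.2 ?_
          rw [neg_div, neg_nonpos]
          positivity
        have h2 : ((s.toNNReal⁻¹ : ℝ≥0) : ℝ) = s⁻¹ := by
          rw [NNReal.coe_inv, Real.coe_toNNReal _ hs.le]
        rw [h2]
        have h3 : 1 / √(s * v) * (√(2 * Real.pi * s⁻¹))⁻¹ = (√(2 * Real.pi * v))⁻¹ := by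
          rw [one_div, ← mul_inv, ← Real.sqrt_mul (by positivity)]
          congr 2
          field_simp
        have h4 : -(a - y) ^ 2 / (2 * s⁻¹) = -(s / 2) * (a - y) ^ 2 := by
          field_simp
        rw [← mul_assoc, h3, h4]
        gcongr
        exact mul_le_of_le_one_right (by positivity) h1
    _ = _ := by
        rw [lintegral_const_mul _ (measurable_gaussianPDF _ _), lintegral_gaussianPDF_eq_one _ hs',
          mul_one]

/-- A Gaussian variable of variance at most `K` satisfies `𝔼 exp (a² / (8K)) ≤ 2`. -/
lemma lintegral_exp_sq_gaussianReal_le {v : ℝ≥0} (hv : v ≠ 0) {K : ℝ} (hK : (v : ℝ) ≤ K) :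
    ∫⁻ a, ENNReal.ofReal (Real.exp (a ^ 2 / (8 * K))) ∂gaussianReal 0 v ≤ 2 := by
  rw [lintegral_gaussianReal hv 0 (by fun_prop)]
  have hv' : (0 : ℝ) < v := by positivity
  have h4 : 4 * v ≠ 0 := by positivity
  calc _ ≤ ∫⁻ a, ENNReal.ofReal 2 * gaussianPDF 0 (4 * v) a := by
        refine lintegral_mono fun a => ?_
        simp only [gaussianPDF]
        rw [← ENNReal.ofReal_mul (gaussianPDFReal_nonneg _ _ _),
          ← ENNReal.ofReal_mul (by positivity)]
        refine ENNReal.ofReal_le_ofReal ?_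
        rw [gaussianPDFReal_def, gaussianPDFReal_def]
        have h1 : √(2 * Real.pi * ((4 * v : ℝ≥0) : ℝ)) = 2 * √(2 * Real.pi * v) := by
          push_cast
          rw [show 2 * Real.pi * (4 * (v : ℝ)) = 2 ^ 2 * (2 * Real.pi * v) by ring,
            Real.sqrt_mul (by positivity), Real.sqrt_sq (by norm_num)]
        rw [h1, mul_assoc, ← Real.exp_add, mul_inv, ← mul_assoc, ← mul_assoc, mul_inv_cancel₀ two_ne_zero,
          one_mul]
        gcongr
        push_cast
        have h2 : a ^ 2 / (8 * K) ≤ a ^ 2 / (8 * v) := by gcongr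
        have h3 : -(a - 0) ^ 2 / (2 * (v : ℝ)) + a ^ 2 / (8 * v)
            = -(a - 0) ^ 2 / (2 * (4 * v)) - a ^ 2 / (4 * v) := by
          field_simp
          ring
        have h5 : 0 ≤ a ^ 2 / (4 * (v : ℝ)) := by positivity
        linarith
    _ = _ := by
        rw [lintegral_const_mul _ (measurable_gaussianPDF _ _), lintegral_gaussianPDF_eq_one _ h4,
          mul_one, ENNReal.ofReal_ofNat]

/-! ### Boxes around a target vector: one and two supports -/

section Box

variable {ι : Type*}

/-- The rows `x` whose block sum over `v` is within `δ` of `y`. -/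
def rowBox (v : Finset ι) (y δ : ℝ) : Set (ι → ℝ) :=
  {x | ∑ j ∈ v, x j ∈ Set.Icc (y - δ) (y + δ)}

/-- The probability that two Gaussian variables of variance `l + m` and covariance `l` are both
within `δ` of `y`, computed by conditioning on their common part. -/
def rowPair (l m : ℝ≥0) (y δ : ℝ) : ℝ≥0∞ :=
  ∫⁻ a, (gaussianReal a m (Set.Icc (y - δ) (y + δ))) ^ 2 ∂gaussianReal 0 l

lemma measurableSet_rowBox (v : Finset ι) (y δ : ℝ) : MeasurableSet (rowBox v y δ) :=
  measurableSet_Icc.preimage (by fun_prop : Measurable fun x : ι → ℝ => ∑ j ∈ v, x j)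

/-- The matrices `X` for which every coordinate of `X v` is within `δ` of that of `y`. -/
def matBox {n : ℕ} (v : Finset ι) (y : Fin n → ℝ) (δ : ℝ) : Set (Fin n → ι → ℝ) :=
  {X | ∀ i, X i ∈ rowBox v (y i) δ}

lemma matBox_eq_pi {n : ℕ} (v : Finset ι) (y : Fin n → ℝ) (δ : ℝ) :
    matBox v y δ = Set.univ.pi fun i => rowBox v (y i) δ := by
  ext X; simp [matBox]

lemma measurableSet_matBox {n : ℕ} (v : Finset ι) (y : Fin n → ℝ) (δ : ℝ) :
    MeasurableSet (matBox v y δ) := by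
  rw [matBox_eq_pi]
  exact MeasurableSet.univ_pi fun i => measurableSet_rowBox _ _ _

variable [Fintype ι] [DecidableEq ι]

lemma stdGauss_rowBox (v : Finset ι) (y δ : ℝ) :
    stdGauss ι (rowBox v y δ) = gaussianReal 0 (v.card : ℝ≥0) (Set.Icc (y - δ) (y + δ)) := by
  rw [← map_sum_stdGauss v, Measure.map_apply (by fun_prop) measurableSet_Icc]
  rfl

lemma measurable_gaussianReal_apply (m : ℝ≥0) {I : Set ℝ} (hI : MeasurableSet I) :
    Measurable fun a => gaussianReal a m I := by
  simp_rw [← fun a => gaussianReal_preimage_const_add m a hI]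
  exact measurable_measure_prodMk_left
    (hI.preimage (by fun_prop : Measurable fun z : ℝ × ℝ => z.1 + z.2))

lemma lintegral_indicator_const_add (m : ℝ≥0) (a : ℝ) {I : Set ℝ} (hI : MeasurableSet I) :
    ∫⁻ b, I.indicator 1 (a + b) ∂gaussianReal 0 m = gaussianReal a m I := by
  rw [← gaussianReal_preimage_const_add m a hI]
  exact lintegral_indicator_one (hI.preimage (by fun_prop : Measurable fun b => a + b))

lemma stdGauss_rowBox_inter {v w : Finset ι} {k l : ℕ} (hv : v.card = k) (hw : w.card = k)
    (hl : (v ∩ w).card = l) (y δ : ℝ) :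
    stdGauss ι (rowBox v y δ ∩ rowBox w y δ) = rowPair l ((k - l : ℕ) : ℝ≥0) y δ := by
  set I := Set.Icc (y - δ) (y + δ) with hI
  have hIm : MeasurableSet I := measurableSet_Icc
  have hvw : (v \ w).card = k - l := by
    have := Finset.card_inter_add_card_sdiff v w
    omega
  have hwv : (w \ v).card = k - l := by
    have := Finset.card_inter_add_card_sdiff w v
    rw [Finset.inter_comm] at this
    omega
  have hsv : ∀ x : ι → ℝ, ∑ j ∈ v, x j = ∑ j ∈ v ∩ w, x j + ∑ j ∈ v \ w, x j := fun x =>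
    (Finset.sum_inter_add_sum_sdiff v w x).symm
  have hsw : ∀ x : ι → ℝ, ∑ j ∈ w, x j = ∑ j ∈ v ∩ w, x j + ∑ j ∈ w \ v, x j := fun x => by
    rw [Finset.inter_comm]
    exact (Finset.sum_inter_add_sum_sdiff w v x).symm
  have hind : Measurable (I.indicator (1 : ℝ → ℝ≥0∞)) := measurable_one.indicator hIm
  have hadd : ∀ a : ℝ, Measurable fun b : ℝ => I.indicator (1 : ℝ → ℝ≥0∞) (a + b) := fun a =>
    hind.comp (by fun_prop : Measurable fun b => a + b)
  have hpw : ∀ (T U : Finset ι) (x x' : ι → ℝ), Disjoint U T →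
      ∑ j ∈ U, T.piecewise x' x j = ∑ j ∈ U, x j := fun T U x x' h =>
    Finset.sum_congr rfl fun j hj => by
      simp [Finset.disjoint_left.1 h hj]
  have hd1 : Disjoint (v ∩ w) (v \ w) := by
    rw [Finset.disjoint_left]; simp only [Finset.mem_inter, Finset.mem_sdiff]; tauto
  have hd2 : Disjoint (w \ v) (v \ w) := by
    rw [Finset.disjoint_left]; simp only [Finset.mem_sdiff]; tauto
  have hd3 : Disjoint (v ∩ w) (w \ v) := by
    rw [Finset.disjoint_left]; simp only [Finset.mem_inter, Finset.mem_sdiff]; tauto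
  have hg := measurable_gaussianReal_apply ((k - l : ℕ) : ℝ≥0) hIm
  calc stdGauss ι (rowBox v y δ ∩ rowBox w y δ)
      = ∫⁻ x, I.indicator 1 (∑ j ∈ v ∩ w, x j + ∑ j ∈ v \ w, x j) *
          I.indicator 1 (∑ j ∈ v ∩ w, x j + ∑ j ∈ w \ v, x j) ∂stdGauss ι := by
        rw [← lintegral_indicator_one
          ((measurableSet_rowBox v y δ).inter (measurableSet_rowBox w y δ))]
        refine lintegral_congr fun x => ?_
        rw [Set.inter_indicator_one, Pi.mul_apply, ← hsv, ← hsw]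
        rfl
    _ = ∫⁻ x, gaussianReal (∑ j ∈ v ∩ w, x j) ((k - l : ℕ) : ℝ≥0) I *
          I.indicator 1 (∑ j ∈ v ∩ w, x j + ∑ j ∈ w \ v, x j) ∂stdGauss ι := by
        rw [lintegral_block_stdGauss (v \ w) (fun b x => I.indicator 1 (∑ j ∈ v ∩ w, x j + b) *
          I.indicator 1 (∑ j ∈ v ∩ w, x j + ∑ j ∈ w \ v, x j))]
        · refine lintegral_congr fun x => ?_
          rw [lintegral_mul_const _ (hadd _),
            lintegral_indicator_const_add _ _ hIm, hvw]
        · exact (hind.comp (by fun_prop)).mul (hind.comp (by fun_prop))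
        · intro a x x'
          rw [hpw _ _ _ _ hd1, hpw _ _ _ _ hd2]
    _ = ∫⁻ x, (gaussianReal (∑ j ∈ v ∩ w, x j) ((k - l : ℕ) : ℝ≥0) I) ^ 2 ∂stdGauss ι := by
        rw [lintegral_block_stdGauss (w \ v) (fun b x =>
          gaussianReal (∑ j ∈ v ∩ w, x j) ((k - l : ℕ) : ℝ≥0) I *
            I.indicator 1 (∑ j ∈ v ∩ w, x j + b))]
        · refine lintegral_congr fun x => ?_
          rw [lintegral_const_mul _ (hadd _),
            lintegral_indicator_const_add _ _ hIm, hwv, sq]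
        · exact (hg.comp (by fun_prop)).mul (hind.comp (by fun_prop))
        · intro a x x'
          rw [hpw _ _ _ _ hd3]
    _ = _ := by
        rw [lintegral_sum_stdGauss (v ∩ w) (hg.pow_const 2), hl]
        rfl

lemma rowPair_zero (m : ℝ≥0) (y δ : ℝ) :
    rowPair 0 m y δ = (gaussianReal 0 m (Set.Icc (y - δ) (y + δ))) ^ 2 := by
  unfold rowPair
  rw [gaussianReal_zero_var,
    lintegral_dirac' _ ((measurable_gaussianReal_apply m measurableSet_Icc).pow_const 2)]

lemma lintegral_gaussianReal_apply (l m : ℝ≥0) {I : Set ℝ} (hI : MeasurableSet I) :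
    ∫⁻ a, gaussianReal a m I ∂gaussianReal 0 l = gaussianReal 0 (l + m) I := by
  have h := gaussianReal_conv_gaussianReal (m₁ := 0) (m₂ := 0) (v₁ := l) (v₂ := m)
  rw [zero_add] at h
  rw [← h, ← lintegral_indicator_one hI, Measure.lintegral_conv (measurable_one.indicator hI)]
  exact lintegral_congr fun a => (lintegral_indicator_const_add m a hI).symm

lemma rowPair_le (l m : ℝ≥0) (y δ : ℝ) :
    rowPair l m y δ ≤ gaussianReal 0 (l + m) (Set.Icc (y - δ) (y + δ)) := by
  rw [← lintegral_gaussianReal_apply l m measurableSet_Icc]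
  refine lintegral_mono fun a => ?_
  change _ ^ 2 ≤ _
  rw [sq]
  exact mul_le_of_le_one_right' prob_le_one

lemma rowPair_le_mul (l : ℝ≥0) {m : ℝ≥0} (hm : m ≠ 0) (y δ : ℝ) :
    rowPair l m y δ ≤ ENNReal.ofReal (2 * δ / √(2 * Real.pi * m)) *
      gaussianReal 0 (l + m) (Set.Icc (y - δ) (y + δ)) := by
  rw [← lintegral_gaussianReal_apply l m measurableSet_Icc,
    ← lintegral_const_mul _ (measurable_gaussianReal_apply m measurableSet_Icc)]
  refine lintegral_mono fun a => ?_
  change _ ^ 2 ≤ _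
  rw [sq]
  gcongr
  refine (gaussianReal_Icc_le a hm _ _).trans (le_of_eq ?_)
  congr 2
  ring

/-- The law of an `n × ι` matrix with independent standard Gaussian entries. -/
abbrev matGauss (n : ℕ) (ι : Type*) [Fintype ι] : Measure (Fin n → ι → ℝ) :=
  Measure.pi fun _ => stdGauss ι

/-- The probability that `X v` is within `δ` of `y`, for a support `v` of size `k`. -/
def boxProb {n : ℕ} (k : ℕ) (y : Fin n → ℝ) (δ : ℝ) : ℝ :=
  (∏ i, gaussianReal 0 (k : ℝ≥0) (Set.Icc (y i - δ) (y i + δ))).toReal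

/-- The probability that `X v` and `X w` are both within `δ` of `y`, for supports `v`, `w` of size
`k` with `l` common elements. -/
def pairProb {n : ℕ} (k l : ℕ) (y : Fin n → ℝ) (δ : ℝ) : ℝ :=
  (∏ i, rowPair l ((k - l : ℕ) : ℝ≥0) (y i) δ).toReal

lemma real_matBox {n k : ℕ} {v : Finset ι} (hv : v.card = k) (y : Fin n → ℝ) (δ : ℝ) :
    (matGauss n ι).real (matBox v y δ) = boxProb k y δ := by
  rw [measureReal_def, matBox_eq_pi, Measure.pi_pi, boxProb]
  simp_rw [stdGauss_rowBox, hv]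

lemma real_matBox_inter {n k l : ℕ} {v w : Finset ι} (hv : v.card = k) (hw : w.card = k)
    (hl : (v ∩ w).card = l) (y : Fin n → ℝ) (δ : ℝ) :
    (matGauss n ι).real (matBox v y δ ∩ matBox w y δ) = pairProb k l y δ := by
  rw [measureReal_def, matBox_eq_pi, matBox_eq_pi, ← Set.pi_inter_distrib, Measure.pi_pi, pairProb]
  simp_rw [fun i => stdGauss_rowBox_inter hv hw hl (y i) δ]

end Box

section Bounds

variable {n : ℕ} (y : Fin n → ℝ) (δ : ℝ)

lemma boxProb_nonneg (k : ℕ) : 0 ≤ boxProb k y δ := ENNReal.toReal_nonneg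

lemma prod_gaussianReal_ne_top (k : ℝ≥0) :
    ∏ i, gaussianReal 0 k (Set.Icc (y i - δ) (y i + δ)) ≠ ∞ :=
  ENNReal.prod_ne_top fun _ _ => measure_ne_top _ _

lemma pairProb_zero (k : ℕ) : pairProb k 0 y δ = boxProb k y δ ^ 2 := by
  unfold pairProb boxProb
  rw [← ENNReal.toReal_pow, ← Finset.prod_pow]
  simp [rowPair_zero]

lemma natCast_add_sub {k l : ℕ} (h : l ≤ k) : (l : ℝ≥0) + ((k - l : ℕ) : ℝ≥0) = k := by
  rw [← Nat.cast_add]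
  congr 1
  omega

lemma pairProb_le {k l : ℕ} (h : l ≤ k) : pairProb k l y δ ≤ boxProb k y δ := by
  unfold pairProb boxProb
  refine ENNReal.toReal_mono (prod_gaussianReal_ne_top _ _ _) ?_
  refine Finset.prod_le_prod' fun i _ => ?_
  rw [← natCast_add_sub h]
  exact rowPair_le _ _ _ _

lemma pairProb_le_mul {k l : ℕ} (h : l < k) (hδ : 0 ≤ δ) :
    pairProb k l y δ ≤ (2 * δ / √(2 * Real.pi * ((k : ℝ) - l))) ^ n * boxProb k y δ := by
  have hm : ((k - l : ℕ) : ℝ≥0) ≠ 0 := by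
    rw [Nat.cast_ne_zero]; omega
  have hc : ((((k - l : ℕ) : ℝ≥0)) : ℝ) = (k : ℝ) - l := by
    rw [NNReal.coe_natCast, Nat.cast_sub h.le]
  have h1 : ∏ i, rowPair l ((k - l : ℕ) : ℝ≥0) (y i) δ ≤
      ENNReal.ofReal (2 * δ / √(2 * Real.pi * ((k : ℝ) - l))) ^ n *
        ∏ i, gaussianReal 0 (k : ℝ≥0) (Set.Icc (y i - δ) (y i + δ)) := by
    calc _ ≤ ∏ i : Fin n, (ENNReal.ofReal (2 * δ / √(2 * Real.pi * ((k : ℝ) - l))) *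
          gaussianReal 0 (k : ℝ≥0) (Set.Icc (y i - δ) (y i + δ))) := by
          refine Finset.prod_le_prod' fun i _ => ?_
          rw [← natCast_add_sub h.le, ← hc]
          exact rowPair_le_mul _ hm _ _
      _ = _ := by rw [Finset.prod_mul_distrib]; simp
  unfold pairProb boxProb
  refine (ENNReal.toReal_mono ?_ h1).trans (le_of_eq ?_)
  · exact ENNReal.mul_ne_top (ENNReal.pow_ne_top ENNReal.ofReal_ne_top)
      (prod_gaussianReal_ne_top _ _ _)
  · rw [ENNReal.toReal_mul, ENNReal.toReal_pow, ENNReal.toReal_ofReal (by positivity)]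

lemma pairProb_le_mul_sq {k l : ℕ} (hl : 0 < l) (h : l < k) :
    pairProb k l y δ ≤ (k / √(((k : ℝ) - l) * (k + l))) ^ n *
      Real.exp (l / k * (∑ i, (|y i| + δ) ^ 2 / k)) * boxProb k y δ ^ 2 := by
  have hm : ((k - l : ℕ) : ℝ≥0) ≠ 0 := by
    rw [Nat.cast_ne_zero]; omega
  have hl' : (l : ℝ≥0) ≠ 0 := by
    rw [Nat.cast_ne_zero]; omega
  have hc : ((((k - l : ℕ) : ℝ≥0)) : ℝ) = (k : ℝ) - l := by
    rw [NNReal.coe_natCast, Nat.cast_sub h.le]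
  have h1 : ∏ i, rowPair l ((k - l : ℕ) : ℝ≥0) (y i) δ ≤
      ENNReal.ofReal ((k / √(((k : ℝ) - l) * (k + l))) ^ n *
        Real.exp (l / k * (∑ i, (|y i| + δ) ^ 2 / k))) *
        (∏ i, gaussianReal 0 (k : ℝ≥0) (Set.Icc (y i - δ) (y i + δ))) ^ 2 := by
    calc _ ≤ ∏ i : Fin n, (ENNReal.ofReal (k / √(((k : ℝ) - l) * (k + l)) *
          Real.exp (l / k * ((|y i| + δ) ^ 2 / k))) *
          (gaussianReal 0 (k : ℝ≥0) (Set.Icc (y i - δ) (y i + δ))) ^ 2) := by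
          refine Finset.prod_le_prod' fun i _ => ?_
          refine (lintegral_sq_gaussianReal_le hl' hm (y i) δ).trans (le_of_eq ?_)
          have hlk : ((l : ℝ≥0) : ℝ) + (((k - l : ℕ) : ℝ≥0) : ℝ) = k := by
            rw [hc, NNReal.coe_natCast]; ring
          rw [natCast_add_sub h.le, hlk, hc, NNReal.coe_natCast]
          congr 4
          · congr 1; ring
          · field_simp
      _ = _ := by
          rw [Finset.prod_mul_distrib, ← ENNReal.ofReal_prod_of_nonneg
            (fun i _ => by positivity), Finset.prod_mul_distrib, ← Real.exp_sum,
            Finset.prod_pow, Finset.mul_sum, Finset.prod_const, Finset.card_univ, Fintype.card_fin]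
  unfold pairProb boxProb
  refine (ENNReal.toReal_mono ?_ h1).trans (le_of_eq ?_)
  · exact ENNReal.mul_ne_top ENNReal.ofReal_ne_top
      (ENNReal.pow_ne_top (prod_gaussianReal_ne_top _ _ _))
  · rw [ENNReal.toReal_mul, ENNReal.toReal_pow, ENNReal.toReal_ofReal (by positivity)]

lemma le_boxProb {k : ℕ} (hk : 0 < k) (hδ : 0 ≤ δ) :
    (2 * δ / √(2 * Real.pi * k)) ^ n * Real.exp (-(∑ i, (|y i| + δ) ^ 2 / k) / 2) ≤
      boxProb k y δ := by
  have hk' : (k : ℝ≥0) ≠ 0 := by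
    rw [Nat.cast_ne_zero]; omega
  have h1 : ENNReal.ofReal ((2 * δ / √(2 * Real.pi * k)) ^ n *
      Real.exp (-(∑ i, (|y i| + δ) ^ 2 / k) / 2)) ≤
      ∏ i, gaussianReal 0 (k : ℝ≥0) (Set.Icc (y i - δ) (y i + δ)) := by
    calc _ = ∏ i : Fin n, ENNReal.ofReal (2 * δ / √(2 * Real.pi * k) *
          Real.exp (-(|y i| + δ) ^ 2 / (2 * k))) := by
          rw [← ENNReal.ofReal_prod_of_nonneg (fun i _ => by positivity),
            Finset.prod_mul_distrib, ← Real.exp_sum]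
          congr 2
          · rw [Finset.prod_const, Finset.card_univ, Fintype.card_fin]
          · rw [neg_div, Finset.sum_div, ← Finset.sum_neg_distrib]
            congr 1
            refine Finset.sum_congr rfl fun i _ => ?_
            ring
      _ ≤ _ := Finset.prod_le_prod' fun i _ => by
          have := le_gaussianReal_Icc hk' (y i) δ
          rwa [NNReal.coe_natCast] at this
  exact (ENNReal.ofReal_le_iff_le_toReal (prod_gaussianReal_ne_top _ _ _)).1 h1

end Bounds

/-! ### The second moment method -/

/-- Chebyshev's inequality for the number of events that occur, among events of equal
probability. -/
lemma measureReal_forall_notMem_le {Ω α : Type*} [MeasurableSpace Ω] (μ : Measure Ω)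
    [IsProbabilityMeasure μ] (s : Finset α) (E : α → Set Ω) (hE : ∀ v, MeasurableSet (E v))
    {q : ℝ} (hq : ∀ v ∈ s, μ.real (E v) = q) :
    μ.real {ω | ∀ v ∈ s, ω ∉ E v} * (s.card * q) ^ 2 ≤
      ∑ v ∈ s, ∑ w ∈ s, (μ.real (E v ∩ E w) - q ^ 2) := by
  set D := {ω | ∀ v ∈ s, ω ∉ E v} with hD
  have hDm : MeasurableSet D := by
    have : D = ⋂ v ∈ s, (E v)ᶜ := by ext ω; simp [hD]
    rw [this]
    exact Finset.measurableSet_biInter s fun v _ => (hE v).compl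
  have hint : ∀ A : Set Ω, MeasurableSet A → Integrable (A.indicator (1 : Ω → ℝ)) μ := fun A hA =>
    (integrable_const (1 : ℝ)).indicator hA
  have hmul : ∀ v w, (fun ω => ((E v).indicator (1 : Ω → ℝ) ω - q) *
      ((E w).indicator (1 : Ω → ℝ) ω - q)) = fun ω => (E v ∩ E w).indicator (1 : Ω → ℝ) ω -
      q * (E v).indicator (1 : Ω → ℝ) ω - q * (E w).indicator (1 : Ω → ℝ) ω + q ^ 2 := fun v w => by
    ext ω
    rw [Set.inter_indicator_one, Pi.mul_apply]
    ring
  have hi1 : ∀ v w, Integrable (fun ω => ((E v).indicator (1 : Ω → ℝ) ω - q) *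
      ((E w).indicator (1 : Ω → ℝ) ω - q)) μ := fun v w => by
    rw [hmul]
    exact (((hint _ ((hE v).inter (hE w))).sub ((hint _ (hE v)).const_mul q)).sub
      ((hint _ (hE w)).const_mul q)).add (integrable_const _)
  have hval : ∀ v ∈ s, ∀ w ∈ s, ∫ ω, ((E v).indicator (1 : Ω → ℝ) ω - q) *
      ((E w).indicator (1 : Ω → ℝ) ω - q) ∂μ = μ.real (E v ∩ E w) - q ^ 2 := fun v hv w hw => by
    rw [hmul, integral_add, integral_sub, integral_sub, integral_const_mul, integral_const_mul,
      integral_indicator_one ((hE v).inter (hE w)), integral_indicator_one (hE v),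
      integral_indicator_one (hE w), hq v hv, hq w hw, integral_const]
    · simp; ring
    · exact hint _ ((hE v).inter (hE w))
    · exact (hint _ (hE v)).const_mul q
    · exact (hint _ ((hE v).inter (hE w))).sub ((hint _ (hE v)).const_mul q)
    · exact (hint _ (hE w)).const_mul q
    · exact ((hint _ ((hE v).inter (hE w))).sub ((hint _ (hE v)).const_mul q)).sub
        ((hint _ (hE w)).const_mul q)
    · exact integrable_const _
  have hsum : ∫ ω, ∑ v ∈ s, ∑ w ∈ s, ((E v).indicator (1 : Ω → ℝ) ω - q) *
      ((E w).indicator (1 : Ω → ℝ) ω - q) ∂μ =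
      ∑ v ∈ s, ∑ w ∈ s, (μ.real (E v ∩ E w) - q ^ 2) := by
    rw [integral_finsetSum _ fun v _ => integrable_finsetSum _ fun w _ => hi1 v w]
    refine Finset.sum_congr rfl fun v hv => ?_
    rw [integral_finsetSum _ fun w _ => hi1 v w]
    exact Finset.sum_congr rfl fun w hw => hval v hv w hw
  rw [← hsum]
  calc μ.real D * (s.card * q) ^ 2 = ∫ ω, D.indicator (1 : Ω → ℝ) ω * (s.card * q) ^ 2 ∂μ := by
        rw [integral_mul_const, integral_indicator_one hDm]
    _ ≤ _ := by
        refine integral_mono ((hint D hDm).mul_const _)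
          (integrable_finsetSum _ fun v _ => integrable_finsetSum _ fun w _ => hi1 v w) fun ω => ?_
        change D.indicator (1 : Ω → ℝ) ω * (s.card * q) ^ 2 ≤
          ∑ v ∈ s, ∑ w ∈ s, ((E v).indicator (1 : Ω → ℝ) ω - q) *
            ((E w).indicator (1 : Ω → ℝ) ω - q)
        rw [← Finset.sum_mul_sum, ← sq]
        by_cases hω : ω ∈ D
        · have : ∑ v ∈ s, ((E v).indicator (1 : Ω → ℝ) ω - q) = -(s.card * q) := by
            rw [Finset.sum_congr rfl fun v hv => by
              rw [Set.indicator_of_notMem (hω v hv), zero_sub]]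
            simp
          rw [this, Set.indicator_of_mem hω, neg_sq]
          simp
        · rw [Set.indicator_of_notMem hω, zero_mul]
          positivity

/-- At most `C(k, l) C(|S|, k - l)` subsets of `S` of size `k` share `l` elements with a set of
size `k`. -/
lemma card_filter_inter_le {ι : Type*} [DecidableEq ι] (S v : Finset ι) {k l : ℕ}
    (hv : v.card = k) :
    ((S.powersetCard k).filter fun w => (v ∩ w).card = l).card ≤
      k.choose l * S.card.choose (k - l) := by
  rw [← hv, ← Finset.card_powersetCard, ← Finset.card_powersetCard, ← Finset.card_product]
  refine Finset.card_le_card_of_injOn (fun w => (v ∩ w, w \ v)) ?_ ?_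
  · intro w hw
    simp only [Finset.coe_filter, Finset.mem_powersetCard, Set.mem_ofPred_eq] at hw
    obtain ⟨⟨h1, h2⟩, h3⟩ := hw
    simp only [Finset.coe_product, Set.mem_prod, Finset.mem_coe, Finset.mem_powersetCard]
    refine ⟨⟨Finset.inter_subset_left, h3⟩, Finset.sdiff_subset.trans h1, ?_⟩
    have := Finset.card_inter_add_card_sdiff w v
    rw [Finset.inter_comm] at this
    omega
  · intro w _ w' _ h
    simp only [Prod.mk.injEq] at h
    have hw : ∀ u : Finset ι, u = (v ∩ u) ∪ (u \ v) := fun u => by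
      ext j; simp only [Finset.mem_union, Finset.mem_inter, Finset.mem_sdiff]; tauto
    rw [hw w, hw w', h.1, h.2]

/-- Second moment bound for the existence of a support `v ⊆ S` of size `k` with `X v` within `δ`
of the fixed vector `y`. Pairs of disjoint supports are independent and do not contribute. -/
lemma real_forall_notMem_matBox_le {ι : Type*} [Fintype ι] [DecidableEq ι] {n : ℕ}
    (S : Finset ι) {k : ℕ} (hk : k ≤ S.card) (y : Fin n → ℝ) (δ : ℝ) (hq : 0 < boxProb k y δ) :
    (matGauss n ι).real {X | ∀ v ∈ S.powersetCard k, X ∉ matBox v y δ} ≤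
      ∑ l ∈ Finset.Icc 1 k, (k.choose l * S.card.choose (k - l) : ℝ) * pairProb k l y δ /
        (S.card.choose k * boxProb k y δ ^ 2) := by
  set q := boxProb k y δ with hq'
  have hcard : ∀ v ∈ S.powersetCard k, v.card = k := fun v hv => (Finset.mem_powersetCard.1 hv).2
  have h1 := measureReal_forall_notMem_le (matGauss n ι) (S.powersetCard k)
    (fun v => matBox v y δ) (fun v => measurableSet_matBox v y δ) (q := q)
    (fun v hv => real_matBox (hcard v hv) y δ)
  have hN : 0 < (S.card.choose k : ℝ) := by exact_mod_cast Nat.choose_pos hk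
  have h2 : ∀ v ∈ S.powersetCard k, ∑ w ∈ S.powersetCard k,
      ((matGauss n ι).real (matBox v y δ ∩ matBox w y δ) - q ^ 2) ≤
      ∑ l ∈ Finset.Icc 1 k, (k.choose l * S.card.choose (k - l) : ℝ) * pairProb k l y δ := by
    intro v hv
    have hmap : ∀ w ∈ S.powersetCard k, (v ∩ w).card ∈ Finset.range (k + 1) := fun w _ => by
      have := Finset.card_le_card (Finset.inter_subset_left (s₁ := v) (s₂ := w))
      rw [hcard v hv] at this
      simpa [Nat.lt_succ_iff] using this
    rw [← Finset.sum_fiberwise_of_maps_to hmap, Finset.sum_range_succ', Finset.range_eq_Ico]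
    have h0 : ∑ w ∈ (S.powersetCard k).filter (fun w => (v ∩ w).card = 0),
        ((matGauss n ι).real (matBox v y δ ∩ matBox w y δ) - q ^ 2) = 0 := by
      refine Finset.sum_eq_zero fun w hw => ?_
      rw [Finset.mem_filter] at hw
      rw [real_matBox_inter (hcard v hv) (hcard w hw.1) hw.2, pairProb_zero, sub_self]
    rw [h0, add_zero, Finset.sum_Ico_add' (fun l => ∑ w ∈ (S.powersetCard k).filter
      (fun w => (v ∩ w).card = l), ((matGauss n ι).real (matBox v y δ ∩ matBox w y δ) - q ^ 2))]
    refine Finset.sum_le_sum fun l _ => ?_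
    calc _ ≤ ∑ w ∈ (S.powersetCard k).filter (fun w => (v ∩ w).card = l), pairProb k l y δ := by
          refine Finset.sum_le_sum fun w hw => ?_
          rw [Finset.mem_filter] at hw
          rw [real_matBox_inter (hcard v hv) (hcard w hw.1) hw.2]
          linarith [sq_nonneg q]
      _ ≤ _ := by
          rw [Finset.sum_const, nsmul_eq_mul]
          refine mul_le_mul_of_nonneg_right ?_ ENNReal.toReal_nonneg
          exact_mod_cast card_filter_inter_le S v (hcard v hv)
  have h3 := h1.trans (Finset.sum_le_sum h2)
  rw [Finset.sum_const, Finset.card_powersetCard, nsmul_eq_mul] at h3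
  rw [← Finset.sum_div, le_div_iff₀ (by positivity)]
  have h4 : (matGauss n ι).real {X | ∀ v ∈ S.powersetCard k, X ∉ matBox v y δ} *
      (S.card.choose k * q ^ 2) * S.card.choose k ≤ (∑ l ∈ Finset.Icc 1 k,
      (k.choose l * S.card.choose (k - l) : ℝ) * pairProb k l y δ) * S.card.choose k := by
    linarith
  exact le_of_mul_le_mul_right h4 hN

/-! ### The Gaussian design: three estimates for a fixed hidden support -/

lemma lintegral_prod_pi {κ α : Type*} [Fintype κ] [MeasurableSpace α] (μ : κ → Measure α)
    [∀ i, IsProbabilityMeasure (μ i)] {f : κ → α → ℝ≥0∞} (hf : ∀ i, Measurable (f i)) :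
    ∫⁻ x, ∏ i, f i (x i) ∂Measure.pi μ = ∏ i, ∫⁻ a, f i a ∂μ i := by
  have h := lintegral_prod_eq_prod_lintegral_of_indepFun (μ := Measure.pi μ) Finset.univ
    (fun i x => f i (x i)) (iIndepFun_pi fun i => (hf i).aemeasurable)
    (fun i => (hf i).comp (measurable_pi_apply i))
  rw [h]
  refine Finset.prod_congr rfl fun i _ => ?_
  exact (measurePreserving_eval μ i).lintegral_comp (hf i)

section Design

variable {ι : Type*} {n : ℕ}

/-- The sums of the columns of `X` in `v`, that is, `X v` for the indicator vector of `v`. -/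
def colSum (X : Fin n → ι → ℝ) (v : Finset ι) : Fin n → ℝ := fun i => ∑ j ∈ v, X i j

lemma measurable_colSum (v : Finset ι) :
    Measurable fun X : Fin n → ι → ℝ => colSum X v := by
  unfold colSum
  fun_prop

lemma measurableSet_setOf_mem_matBox (v : Finset ι) (δ : ℝ) :
    MeasurableSet {z : (Fin n → ι → ℝ) × (Fin n → ℝ) | z.1 ∈ matBox v z.2 δ} := by
  have : {z : (Fin n → ι → ℝ) × (Fin n → ℝ) | z.1 ∈ matBox v z.2 δ} =
      ⋂ i, ({z | z.2 i - δ ≤ ∑ j ∈ v, z.1 i j} ∩ {z | ∑ j ∈ v, z.1 i j ≤ z.2 i + δ}) := by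
    ext z
    simp [matBox, rowBox]
  rw [this]
  refine MeasurableSet.iInter fun i => MeasurableSet.inter ?_ ?_
  · exact measurableSet_le (by fun_prop) (by fun_prop)
  · exact measurableSet_le (by fun_prop) (by fun_prop)

variable [Fintype ι] [DecidableEq ι]

lemma lintegral_row_pair_le {v₀ v u : Finset ι} {k m : ℕ} (hk : v₀.card = k) (hu : Disjoint v₀ u)
    (hm : (v₀ \ v).card = m) (hm0 : 0 < m) (hmk : m < k) {s₁ s₂ : ℝ} (hs₁ : 0 < s₁) (hs₂ : 0 < s₂)
    (w : ℝ) :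
    ∫⁻ x, ENNReal.ofReal (Real.exp (-(s₁ / 2) * (∑ j ∈ u, x j + w - ∑ j ∈ v₀, x j) ^ 2)) *
        ENNReal.ofReal (Real.exp (-(s₂ / 2) * (∑ j ∈ v, x j - ∑ j ∈ v₀, x j) ^ 2)) ∂stdGauss ι ≤
      ENNReal.ofReal (1 / √(s₁ * ((k : ℝ) - m)) * (1 / √(s₂ * m))) := by
  have hc : (v₀ ∩ v).card = k - m := by
    have := Finset.card_inter_add_card_sdiff v₀ v
    omega
  have hs0 : ∀ x : ι → ℝ, ∑ j ∈ v₀, x j = ∑ j ∈ v₀ ∩ v, x j + ∑ j ∈ v₀ \ v, x j := fun x =>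
    (Finset.sum_inter_add_sum_sdiff v₀ v x).symm
  have hsv : ∀ x : ι → ℝ, ∑ j ∈ v, x j = ∑ j ∈ v₀ ∩ v, x j + ∑ j ∈ v \ v₀, x j := fun x => by
    rw [Finset.inter_comm]
    exact (Finset.sum_inter_add_sum_sdiff v v₀ x).symm
  have hpw : ∀ (T U : Finset ι) (x x' : ι → ℝ), Disjoint U T →
      ∑ j ∈ U, T.piecewise x' x j = ∑ j ∈ U, x j := fun T U x x' h =>
    Finset.sum_congr rfl fun j hj => by
      simp [Finset.disjoint_left.1 h hj]
  have hd1 : Disjoint u (v₀ ∩ v) := (hu.mono_left Finset.inter_subset_left).symm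
  have hd2 : Disjoint (v₀ \ v) (v₀ ∩ v) := by
    rw [Finset.disjoint_left]; simp only [Finset.mem_inter, Finset.mem_sdiff]; tauto
  have hd3 : Disjoint (v \ v₀) (v₀ ∩ v) := by
    rw [Finset.disjoint_left]; simp only [Finset.mem_inter, Finset.mem_sdiff]; tauto
  have hd4 : Disjoint (v \ v₀) (v₀ \ v) := by
    rw [Finset.disjoint_left]; simp only [Finset.mem_sdiff]; tauto
  have hkm : (((k - m : ℕ) : ℝ≥0) : ℝ) = (k : ℝ) - m := by
    rw [NNReal.coe_natCast, Nat.cast_sub hmk.le]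
  have hkm0 : ((k - m : ℕ) : ℝ≥0) ≠ 0 := by rw [Nat.cast_ne_zero]; omega
  have hm0' : (m : ℝ≥0) ≠ 0 := by rw [Nat.cast_ne_zero]; omega
  calc _ = ∫⁻ x, ENNReal.ofReal (Real.exp (-(s₁ / 2) * (∑ j ∈ v₀ ∩ v, x j -
          (∑ j ∈ u, x j + w - ∑ j ∈ v₀ \ v, x j)) ^ 2)) *
        ENNReal.ofReal (Real.exp (-(s₂ / 2) * (∑ j ∈ v₀ \ v, x j - ∑ j ∈ v \ v₀, x j) ^ 2))
          ∂stdGauss ι := by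
        refine lintegral_congr fun x => ?_
        rw [hs0, hsv]
        congr 4 <;> ring
    _ = ∫⁻ x, ∫⁻ a, ENNReal.ofReal (Real.exp (-(s₁ / 2) * (a -
          (∑ j ∈ u, x j + w - ∑ j ∈ v₀ \ v, x j)) ^ 2)) *
        ENNReal.ofReal (Real.exp (-(s₂ / 2) * (∑ j ∈ v₀ \ v, x j - ∑ j ∈ v \ v₀, x j) ^ 2))
          ∂gaussianReal 0 ((v₀ ∩ v).card : ℝ≥0) ∂stdGauss ι := by
        refine lintegral_block_stdGauss (v₀ ∩ v) (fun a x =>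
          ENNReal.ofReal (Real.exp (-(s₁ / 2) * (a -
          (∑ j ∈ u, x j + w - ∑ j ∈ v₀ \ v, x j)) ^ 2)) *
        ENNReal.ofReal (Real.exp (-(s₂ / 2) * (∑ j ∈ v₀ \ v, x j - ∑ j ∈ v \ v₀, x j) ^ 2))) ?_ ?_
        · unfold Function.uncurry
          fun_prop
        · intro a x x'
          rw [hpw _ _ _ _ hd1, hpw _ _ _ _ hd2, hpw _ _ _ _ hd3]
    _ ≤ ∫⁻ x, ENNReal.ofReal (1 / √(s₁ * ((k : ℝ) - m))) *
        ENNReal.ofReal (Real.exp (-(s₂ / 2) * (∑ j ∈ v₀ \ v, x j - ∑ j ∈ v \ v₀, x j) ^ 2))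
          ∂stdGauss ι := by
        refine lintegral_mono fun x => ?_
        rw [lintegral_mul_const _ (by fun_prop), hc, ← hkm]
        gcongr
        exact lintegral_exp_neg_sq_gaussianReal_le hkm0 hs₁ _
    _ = ENNReal.ofReal (1 / √(s₁ * ((k : ℝ) - m))) * ∫⁻ x, ∫⁻ b,
        ENNReal.ofReal (Real.exp (-(s₂ / 2) * (b - ∑ j ∈ v \ v₀, x j) ^ 2))
          ∂gaussianReal 0 ((v₀ \ v).card : ℝ≥0) ∂stdGauss ι := by
        rw [lintegral_const_mul _ (by fun_prop)]
        congr 1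
        refine lintegral_block_stdGauss (v₀ \ v) (fun b x =>
          ENNReal.ofReal (Real.exp (-(s₂ / 2) * (b - ∑ j ∈ v \ v₀, x j) ^ 2))) ?_ ?_
        · unfold Function.uncurry
          fun_prop
        · intro a x x'
          rw [hpw _ _ _ _ hd4]
    _ ≤ ENNReal.ofReal (1 / √(s₁ * ((k : ℝ) - m))) * ∫⁻ _x : ι → ℝ,
        ENNReal.ofReal (1 / √(s₂ * m)) ∂stdGauss ι := by
        gcongr with x
        rw [hm]
        have := lintegral_exp_neg_sq_gaussianReal_le hm0' hs₂ (∑ j ∈ v \ v₀, x j)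
        rwa [NNReal.coe_natCast] at this
    _ = _ := by
        rw [lintegral_const, measure_univ, mul_one, ← ENNReal.ofReal_mul (by positivity)]

/-- If `v₀` avoids the hidden support `u`, it is unlikely that both the residual `Y - X v₀` and the
difference `X v - X v₀` are short. -/
lemma matGauss_pair_le {v₀ v u : Finset ι} {k m : ℕ} (hk : v₀.card = k) (hu : Disjoint v₀ u)
    (hm : (v₀ \ v).card = m) (hm0 : 0 < m) (hmk : m < k) {s₁ s₂ r₁ r₂ : ℝ} (hs₁ : 0 < s₁)
    (hs₂ : 0 < s₂) (w : Fin n → ℝ) :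
    matGauss n ι {X | ∑ i, (colSum X u i + w i - colSum X v₀ i) ^ 2 ≤ r₁ ∧
        ∑ i, (colSum X v i - colSum X v₀ i) ^ 2 ≤ r₂} ≤
      ENNReal.ofReal (Real.exp ((s₁ * r₁ + s₂ * r₂) / 2) *
        (1 / √(s₁ * ((k : ℝ) - m)) * (1 / √(s₂ * m))) ^ n) := by
  set f : Fin n → (ι → ℝ) → ℝ≥0∞ := fun i x =>
    ENNReal.ofReal (Real.exp (-(s₁ / 2) * (∑ j ∈ u, x j + w i - ∑ j ∈ v₀, x j) ^ 2)) *
        ENNReal.ofReal (Real.exp (-(s₂ / 2) * (∑ j ∈ v, x j - ∑ j ∈ v₀, x j) ^ 2)) with hf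
  have hfm : ∀ i, Measurable (f i) := fun i => by
    simp only [hf]
    fun_prop
  set A := {X : Fin n → ι → ℝ | ∑ i, (colSum X u i + w i - colSum X v₀ i) ^ 2 ≤ r₁ ∧
        ∑ i, (colSum X v i - colSum X v₀ i) ^ 2 ≤ r₂} with hA
  have hAm : MeasurableSet A := by
    have h : ∀ (a b : (Fin n → ι → ℝ) → Fin n → ℝ) (r : ℝ), Measurable a → Measurable b →
        MeasurableSet {X | ∑ i, (a X i - b X i) ^ 2 ≤ r} := fun a b r ha hb =>
      measurableSet_le (by fun_prop) measurable_const
    exact (h (fun X => colSum X u + w) (fun X => colSum X v₀) r₁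
      ((measurable_colSum u).add_const w) (measurable_colSum v₀)).inter
      (h _ _ r₂ (measurable_colSum v) (measurable_colSum v₀))
  calc matGauss n ι A = ∫⁻ X, A.indicator 1 X ∂matGauss n ι := (lintegral_indicator_one hAm).symm
    _ ≤ ∫⁻ X, ENNReal.ofReal (Real.exp ((s₁ * r₁ + s₂ * r₂) / 2)) * ∏ i, f i (X i)
        ∂matGauss n ι := by
        refine lintegral_mono fun X => ?_
        by_cases hX : X ∈ A
        · simp only [hf, Set.indicator_of_mem hX, Pi.one_apply]
          rw [Finset.prod_mul_distrib, ← ENNReal.ofReal_prod_of_nonneg fun i _ => (Real.exp_pos _).le,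
            ← ENNReal.ofReal_prod_of_nonneg fun i _ => (Real.exp_pos _).le, ← Real.exp_sum,
            ← Real.exp_sum, ← ENNReal.ofReal_mul (Real.exp_pos _).le,
            ← ENNReal.ofReal_mul (Real.exp_pos _).le, ← Real.exp_add, ← Real.exp_add,
            ENNReal.one_le_ofReal, Real.one_le_exp_iff, ← Finset.mul_sum, ← Finset.mul_sum]
          obtain ⟨h1, h2⟩ := hX
          have h3 := mul_le_mul_of_nonneg_left h1 hs₁.le
          have h4 := mul_le_mul_of_nonneg_left h2 hs₂.le
          simp only [colSum] at h3 h4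
          linarith
        · simp [Set.indicator_of_notMem hX]
    _ = ENNReal.ofReal (Real.exp ((s₁ * r₁ + s₂ * r₂) / 2)) * ∏ i, ∫⁻ x, f i x ∂stdGauss ι := by
        rw [lintegral_const_mul _ (by fun_prop), lintegral_prod_pi _ hfm]
    _ ≤ ENNReal.ofReal (Real.exp ((s₁ * r₁ + s₂ * r₂) / 2)) *
        ∏ _i : Fin n, ENNReal.ofReal (1 / √(s₁ * ((k : ℝ) - m)) * (1 / √(s₂ * m))) := by
        gcongr with i
        exact lintegral_row_pair_le hk hu hm hm0 hmk hs₁ hs₂ (w i)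
    _ = _ := by
        rw [← ENNReal.ofReal_prod_of_nonneg (fun i _ => by positivity),
          ← ENNReal.ofReal_mul (Real.exp_pos _).le, Finset.prod_const, Finset.card_univ,
          Fintype.card_fin]

/-- Exponential Markov bound for the length of the response. -/
lemma prod_response_tail {u : Finset ι} {k : ℕ} (hu : u.card = k) (hk : 0 < k) {σsq : ℝ≥0}
    (hσ0 : σsq ≠ 0) (hσ : (σsq : ℝ) ≤ k) (r : ℝ) :
    (matGauss n ι).prod (Measure.pi fun _ : Fin n => gaussianReal 0 σsq)
      {z | 16 * k * (2 * n + r) < ∑ i, (colSum z.1 u i + z.2 i) ^ 2} ≤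
      ENNReal.ofReal (Real.exp (-r)) := by
  obtain ⟨K, hK⟩ : ∃ K : ℝ, K = k := ⟨_, rfl⟩
  rw [← hK] at hσ ⊢
  have hK0 : 0 < K := by rw [hK]; exact_mod_cast hk
  set e : ℝ → ℝ≥0∞ := fun a => ENNReal.ofReal (Real.exp (a ^ 2 / (8 * K))) with he
  have hem : Measurable e := by simp only [he]; fun_prop
  set A := {z : (Fin n → ι → ℝ) × (Fin n → ℝ) |
    16 * K * (2 * n + r) < ∑ i, (colSum z.1 u i + z.2 i) ^ 2} with hA
  have hAm : MeasurableSet A := by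
    refine measurableSet_lt measurable_const ?_
    unfold colSum; fun_prop
  calc _ = ∫⁻ z, A.indicator 1 z ∂(matGauss n ι).prod
        (Measure.pi fun _ : Fin n => gaussianReal 0 σsq) := (lintegral_indicator_one hAm).symm
    _ ≤ ∫⁻ z : (Fin n → ι → ℝ) × (Fin n → ℝ), ENNReal.ofReal (Real.exp (-(2 * n + r))) *
        ((∏ i, e (∑ j ∈ u, z.1 i j)) * ∏ i, e (z.2 i)) ∂(matGauss n ι).prod
        (Measure.pi fun _ : Fin n => gaussianReal 0 σsq) := by
        refine lintegral_mono fun z => ?_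
        by_cases hz : z ∈ A
        · simp only [he, Set.indicator_of_mem hz, Pi.one_apply]
          rw [← ENNReal.ofReal_prod_of_nonneg fun i _ => (Real.exp_pos _).le,
            ← ENNReal.ofReal_prod_of_nonneg fun i _ => (Real.exp_pos _).le, ← Real.exp_sum,
            ← Real.exp_sum, ← ENNReal.ofReal_mul (Real.exp_pos _).le,
            ← ENNReal.ofReal_mul (Real.exp_pos _).le, ← Real.exp_add, ← Real.exp_add,
            ENNReal.one_le_ofReal, Real.one_le_exp_iff, ← Finset.sum_div, ← Finset.sum_div]
          have h1 : ∑ i, (colSum z.1 u i + z.2 i) ^ 2 ≤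
              2 * (∑ i, (∑ j ∈ u, z.1 i j) ^ 2 + ∑ i, z.2 i ^ 2) := by
            rw [← Finset.sum_add_distrib, Finset.mul_sum]
            refine Finset.sum_le_sum fun i _ => ?_
            simp only [colSum]
            nlinarith [sq_nonneg (∑ j ∈ u, z.1 i j - z.2 i)]
          have h2 : 16 * K * (2 * n + r) <
              2 * (∑ i, (∑ j ∈ u, z.1 i j) ^ 2 + ∑ i, z.2 i ^ 2) := lt_of_lt_of_le hz h1
          rw [← add_div]
          have h3 : 2 * n + r ≤ (∑ i, (∑ j ∈ u, z.1 i j) ^ 2 + ∑ i, z.2 i ^ 2) / (8 * K) := by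
            rw [le_div_iff₀ (by positivity)]
            linarith
          linarith
        · simp [Set.indicator_of_notMem hz]
    _ = ENNReal.ofReal (Real.exp (-(2 * n + r))) * ((∏ _i : Fin n, ∫⁻ a, e a ∂gaussianReal 0 (k : ℝ≥0)) *
        ∏ _i : Fin n, ∫⁻ a, e a ∂gaussianReal 0 σsq) := by
        have hx : Measurable fun X : Fin n → ι → ℝ => ∏ i, e (∑ j ∈ u, X i j) := by
          simp only [he]; fun_prop
        have hw : Measurable fun w : Fin n → ℝ => ∏ i, e (w i) := by simp only [he]; fun_prop
        have hxw : Measurable fun z : (Fin n → ι → ℝ) × (Fin n → ℝ) =>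
            (∏ i, e (∑ j ∈ u, z.1 i j)) * ∏ i, e (z.2 i) :=
          (hx.comp measurable_fst).mul (hw.comp measurable_snd)
        rw [lintegral_const_mul _ hxw, lintegral_prod_mul hx.aemeasurable hw.aemeasurable,
          lintegral_prod_pi _ (fun _ => hem),
          lintegral_prod_pi (fun _ : Fin n => stdGauss ι) (f := fun _ x => e (∑ j ∈ u, x j))
            (fun _ => by fun_prop)]
        simp_rw [lintegral_sum_stdGauss u hem, hu]
    _ ≤ ENNReal.ofReal (Real.exp (-(2 * n + r))) * ((∏ _i : Fin n, 2) * ∏ _i : Fin n, 2) := by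
        have hk' : (k : ℝ≥0) ≠ 0 := by rw [Nat.cast_ne_zero]; omega
        gcongr with i _ i _
        · exact lintegral_exp_sq_gaussianReal_le hk' (by rw [NNReal.coe_natCast, hK])
        · exact lintegral_exp_sq_gaussianReal_le hσ0 hσ
    _ ≤ _ := by
        have h4 : (∏ _i : Fin n, (2 : ℝ≥0∞)) * ∏ _i : Fin n, 2 = ENNReal.ofReal (4 ^ n) := by
          rw [Finset.prod_const, Finset.card_univ, Fintype.card_fin, ← mul_pow,
            ENNReal.ofReal_pow (by norm_num)]
          norm_num
        rw [h4, ← ENNReal.ofReal_mul (Real.exp_pos _).le]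
        refine ENNReal.ofReal_le_ofReal ?_
        have h5 : (4 : ℝ) ≤ Real.exp 2 := by
          have h6 : (2 : ℝ) ≤ Real.exp 1 := by have := Real.add_one_le_exp (1 : ℝ); linarith
          rw [show (2 : ℝ) = 1 + 1 by norm_num, Real.exp_add]
          nlinarith
        calc Real.exp (-(2 * n + r)) * 4 ^ n ≤ Real.exp (-(2 * n + r)) * Real.exp 2 ^ n := by gcongr
          _ = _ := by
            rw [← Real.exp_nat_mul, ← Real.exp_add]
            congr 1
            ring

/-- The columns in `S`, disjoint from the hidden support `u`, are independent of the response: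
a bound for the absence of a solution in `S` for each fixed target in `G` yields one for the actual
response. -/
lemma matGauss_response_forall_notMem_le {u S : Finset ι} (hS : Disjoint u S) {k : ℕ} {δ : ℝ}
    {G : Set (Fin n → ℝ)} (hG : MeasurableSet G) (w : Fin n → ℝ) {ε : ℝ≥0∞}
    (hε : ∀ y ∈ G, matGauss n ι {X | ∀ v ∈ S.powersetCard k, X ∉ matBox v y δ} ≤ ε) :
    matGauss n ι {X | colSum X u + w ∈ G ∧
      ∀ v ∈ S.powersetCard k, X ∉ matBox v (colSum X u + w) δ} ≤ ε := by
  set A := {X : Fin n → ι → ℝ | colSum X u + w ∈ G ∧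
      ∀ v ∈ S.powersetCard k, X ∉ matBox v (colSum X u + w) δ} with hA
  have hAm : MeasurableSet A := by
    have : A = (fun X => colSum X u + w) ⁻¹' G ∩ ⋂ v ∈ S.powersetCard k,
        (fun X => (X, colSum X u + w)) ⁻¹' {z | z.1 ∈ matBox v z.2 δ}ᶜ := by
      ext X; simp [hA]
    rw [this]
    have hc : Measurable fun X : Fin n → ι → ℝ => colSum X u + w :=
      (measurable_colSum u).add_const w
    refine (hG.preimage hc).inter (Finset.measurableSet_biInter _ fun v _ => ?_)
    exact (measurableSet_setOf_mem_matBox v δ).compl.preimage (measurable_id.prodMk hc)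
  have hmp := measurePreserving_piecewise_matrix (κ := Fin n) (fun _ : ι => gaussianReal 0 1) S
  rw [← hmp.measure_preimage hAm.nullMeasurableSet, Measure.prod_apply (hmp.measurable hAm)]
  have hsec : ∀ X : Fin n → ι → ℝ, matGauss n ι (Prod.mk X ⁻¹' ((fun z : (Fin n → ι → ℝ) ×
      (Fin n → ι → ℝ) => fun i => S.piecewise (z.2 i) (z.1 i)) ⁻¹' A)) ≤ ε := fun X => by
    have hcol : ∀ X' : Fin n → ι → ℝ,
        colSum (fun i => S.piecewise (X' i) (X i)) u = colSum X u := fun X' => by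
      ext i
      exact Finset.sum_congr rfl fun j hj => by simp [Finset.disjoint_left.1 hS hj]
    have hbox : ∀ (X' : Fin n → ι → ℝ) (y : Fin n → ℝ), ∀ v ∈ S.powersetCard k,
        ((fun i => S.piecewise (X' i) (X i)) ∈ matBox v y δ ↔ X' ∈ matBox v y δ) := by
      intro X' y v hv
      have hvS := (Finset.mem_powersetCard.1 hv).1
      have : ∀ i, ∑ j ∈ v, S.piecewise (X' i) (X i) j = ∑ j ∈ v, X' i j := fun i =>
        Finset.sum_congr rfl fun j hj => by simp [hvS hj]
      simp only [matBox, rowBox, Set.mem_ofPred_eq, this]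
    by_cases hXG : colSum X u + w ∈ G
    · refine (measure_mono ?_).trans (hε _ hXG)
      intro X' hX' v hv
      have h2 := hX'.2 v hv
      simp only [hcol] at h2
      rwa [hbox X' _ v hv] at h2
    · have : Prod.mk X ⁻¹' ((fun z : (Fin n → ι → ℝ) × (Fin n → ι → ℝ) => fun i =>
          S.piecewise (z.2 i) (z.1 i)) ⁻¹' A) = ∅ := by
        ext X'
        simp only [Set.mem_preimage, Set.mem_empty_iff_false, iff_false]
        intro hX'
        have h2 := hX'.1
        simp only [hcol] at h2
        exact hXG h2
      rw [this, measure_empty]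
      exact zero_le
  refine (lintegral_mono hsec).trans ?_
  rw [lintegral_const]
  simp

end Design

/-! ### Numerical estimates -/

/-- The relations between the sample size, the dimension and the sparsity on which the estimates
below rest. The last one is a consequence of Stirling's formula for large `k`; the factor `2 ^ k`
makes room for supports confined to half of the columns. -/
structure Regime (n p k : ℕ) : Prop where
  n_pos : 0 < n
  two_le_k : 2 ≤ k
  sq_le : 16 * k ^ 2 ≤ p
  n_le : (n : ℝ) ≤ k * Real.log (p / k) / 2000
  le_log : 40 ≤ Real.log (p / k)
  factorial_le : Real.exp (k / 4) * (2 * 2 ^ k * (k.factorial : ℝ)) ≤ (k : ℝ) ^ k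

/-- The accuracy per coordinate, chosen so that the expected number of supports `v` with `X v` this
close to `Y` is exponential in `k + n`, but not in `k log (p / k)`. -/
def radius (n p k : ℕ) : ℝ := √k * Real.exp (100 - k * Real.log (p / k) / n)

lemma pow_div_factorial_mul_le (k m : ℕ) :
    (k : ℝ) ^ m / m.factorial ≤ Real.exp (k / 50 + 4 * m) := by
  have h1 := Real.pow_div_factorial_le_exp ((k : ℝ) / 50) (by positivity) m
  have h2 : (50 : ℝ) ≤ Real.exp 4 := by
    have h3 := Real.exp_one_gt_d9
    have h4 : Real.exp 4 = Real.exp 1 ^ 4 := by rw [← Real.exp_nat_mul]; norm_num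
    rw [h4]
    calc (50 : ℝ) ≤ 2.7 ^ 4 := by norm_num
      _ ≤ _ := by gcongr; linarith
  calc (k : ℝ) ^ m / m.factorial = (k / 50) ^ m / m.factorial * 50 ^ m := by
        rw [div_pow]; field_simp
    _ ≤ Real.exp (k / 50) * Real.exp 4 ^ m := by gcongr
    _ = _ := by rw [← Real.exp_nat_mul, ← Real.exp_add]; congr 1; ring

lemma pow_div_factorial_le (k m : ℕ) : (k : ℝ) ^ m / m.factorial ≤ Real.exp k :=
  Real.pow_div_factorial_le_exp _ (by positivity) m

lemma mul_div_mul_sq_le {A E P F q N : ℝ} (hA : A ≤ E) (hP : P ≤ F * q) (hP0 : 0 ≤ P)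
    (hE0 : 0 ≤ E) (hN : 0 < N) (hq : 0 < q) : A * P / (N * q ^ 2) ≤ E * F / (N * q) := by
  calc A * P / (N * q ^ 2) ≤ E * (F * q) / (N * q ^ 2) := by gcongr
    _ = E * F / (N * q) := by field_simp

namespace Regime

variable {n p k : ℕ} (h : Regime n p k)
include h

lemma k_pos : (0 : ℝ) < k := by
  have := h.two_le_k
  exact_mod_cast (by omega : 0 < k)

lemma n_pos' : (0 : ℝ) < n := by exact_mod_cast h.n_pos

lemma sq_le' : 16 * (k : ℝ) ^ 2 ≤ p := by exact_mod_cast h.sq_le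

lemma two_le_k' : (2 : ℝ) ≤ k := by exact_mod_cast h.two_le_k

lemma p_pos : (0 : ℝ) < p := by
  have := h.sq_le'
  have := h.k_pos
  have : 0 < (k : ℝ) ^ 2 := by positivity
  linarith

lemma exp_log : Real.exp (Real.log (p / k)) = p / k := Real.exp_log (div_pos h.p_pos h.k_pos)

lemma pow_eq (m : ℕ) : (p : ℝ) ^ m = Real.exp (m * Real.log (p / k)) * k ^ m := by
  rw [Real.exp_nat_mul, h.exp_log, ← mul_pow, div_mul_cancel₀ _ h.k_pos.ne']

lemma choose_le (m : ℕ) :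
    (p.choose m : ℝ) ≤ Real.exp (m * Real.log (p / k)) * ((k : ℝ) ^ m / m.factorial) := by
  refine (Nat.choose_le_pow_div m p).trans (le_of_eq ?_)
  rw [h.pow_eq, mul_div_assoc]

lemma choose_le' (m : ℕ) :
    (p.choose m : ℝ) ≤ Real.exp (m * Real.log (p / k) + k) := by
  rw [Real.exp_add]
  refine (h.choose_le m).trans ?_
  gcongr
  exact pow_div_factorial_le k m

lemma radius_sq : radius n p k ^ 2 = k * Real.exp (200 - 2 * (k * Real.log (p / k) / n)) := by
  unfold radius
  rw [mul_pow, Real.sq_sqrt h.k_pos.le, ← Real.exp_nat_mul]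
  congr 2
  push_cast
  ring

lemma le_ratio : 2000 ≤ k * Real.log (p / k) / n := by
  rw [le_div_iff₀ h.n_pos']
  linarith [h.n_le]

lemma radius_sq_le : radius n p k ^ 2 ≤ k := by
  rw [h.radius_sq]
  refine mul_le_of_le_one_right h.k_pos.le (Real.exp_le_one_iff.2 ?_)
  linarith [h.le_ratio]

lemma radius_pos : 0 < radius n p k := by
  have := h.k_pos
  unfold radius
  positivity

/-- Targets that are not too long are not too far in the tail of the Gaussian law of `X v`. -/
lemma sum_sq_le {y : Fin n → ℝ} (hy : ∑ i, y i ^ 2 ≤ 16 * k * (2 * n + k / 320)) :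
    ∑ i, (|y i| + radius n p k) ^ 2 / k ≤ 66 * n + k / 10 := by
  have hk := h.k_pos
  have h1 : ∀ i, (|y i| + radius n p k) ^ 2 ≤ 2 * y i ^ 2 + 2 * k := fun i => by
    have := h.radius_sq_le
    nlinarith [sq_nonneg (|y i| - radius n p k), sq_abs (y i)]
  rw [← Finset.sum_div, div_le_iff₀ hk]
  calc ∑ i, (|y i| + radius n p k) ^ 2 ≤ ∑ i, (2 * y i ^ 2 + 2 * k) :=
        Finset.sum_le_sum fun i _ => h1 i
    _ = 2 * ∑ i, y i ^ 2 + 2 * k * n := by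
        rw [Finset.sum_add_distrib, ← Finset.mul_sum]
        simp
        ring
    _ ≤ _ := by linarith

lemma half_sub_le : (p : ℝ) / 4 ≤ ((p - k) / 2 : ℕ) - k := by
  have h1 := h.sq_le
  have h2 := h.two_le_k
  have h3 : k ≤ k ^ 2 := Nat.le_self_pow two_ne_zero k
  have h4 : p ≤ 4 * ((p - k) / 2) - 4 * k := by omega
  have h5 : p + 4 * k ≤ 4 * ((p - k) / 2) := by omega
  have h6 : (p : ℝ) + 4 * k ≤ 4 * ((p - k) / 2 : ℕ) := by exact_mod_cast h5
  linarith

lemma le_half : k ≤ (p - k) / 2 := by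
  have h1 := h.sq_le
  have h2 := h.two_le_k
  have h3 : k ≤ k ^ 2 := Nat.le_self_pow two_ne_zero k
  omega

/-- Half of the columns still carry exponentially many more supports than `(p / k) ^ k`. -/
lemma le_choose_half :
    Real.exp (k / 4) * Real.exp (k * Real.log (p / k)) ≤ (((p - k) / 2).choose k : ℝ) := by
  have hk := h.k_pos
  have hp := h.p_pos
  have h1 : ((p : ℝ) - 3 * k) / 2 ≤ (((p - k) / 2 + 1 - k : ℕ) : ℝ) := by
    have h2 := h.sq_le
    have h3 := h.two_le_k
    have h4 : k ≤ k ^ 2 := Nat.le_self_pow two_ne_zero k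
    have h5 : p ≤ 2 * ((p - k) / 2 + 1 - k) + 3 * k := by omega
    have h6 : (p : ℝ) ≤ 2 * (((p - k) / 2 + 1 - k : ℕ) : ℝ) + 3 * k := by exact_mod_cast h5
    linarith
  have h2 : (1 : ℝ) / 2 ≤ (1 - 3 * k / p) ^ k := by
    have h3 : (3 * k / p : ℝ) ≤ 1 / 2 := by
      rw [div_le_iff₀ hp]
      nlinarith [h.sq_le', h.two_le_k']
    have h4 := one_add_mul_le_pow (a := -(3 * k / p : ℝ)) (by linarith) k
    have h5 : (k : ℝ) * (3 * k / p) ≤ 1 / 2 := by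
      rw [← mul_div_assoc, div_le_iff₀ hp]
      nlinarith [h.sq_le']
    rw [sub_eq_add_neg]
    linarith
  have h3 : (1 / 2 : ℝ) * (p / 2) ^ k ≤ (((p : ℝ) - 3 * k) / 2) ^ k := by
    have : ((p : ℝ) - 3 * k) / 2 = (1 - 3 * k / p) * (p / 2) := by field_simp
    rw [this, mul_pow]
    gcongr
  have h0 : (0 : ℝ) ≤ ((p : ℝ) - 3 * k) / 2 := by nlinarith [h.sq_le', h.two_le_k']
  refine le_trans ?_ (Nat.pow_le_choose k ((p - k) / 2))
  rw [le_div_iff₀ (by positivity)]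
  refine le_trans ?_ (pow_le_pow_left₀ h0 h1 k)
  refine le_trans ?_ h3
  have h4 := h.factorial_le
  rw [div_pow, h.pow_eq k]
  have h5 : 0 < Real.exp (k * Real.log (p / k)) := Real.exp_pos _
  have h6 := mul_le_mul_of_nonneg_left h4 h5.le
  have h7 : (0 : ℝ) < 2 ^ k := by positivity
  calc Real.exp (k / 4) * Real.exp (k * Real.log (p / k)) * k.factorial
      = Real.exp (k * Real.log (p / k)) * (Real.exp (k / 4) * (2 * 2 ^ k * k.factorial)) /
        (2 * 2 ^ k) := by field_simp
    _ ≤ Real.exp (k * Real.log (p / k)) * k ^ k / (2 * 2 ^ k) := by gcongr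
    _ = _ := by ring

/-- The expected number of supports in half of the columns that solve the system up to accuracy
`radius` is exponentially large. -/
lemma le_expected {y : Fin n → ℝ} (hy : ∑ i, y i ^ 2 ≤ 16 * k * (2 * n + k / 320)) :
    Real.exp (k / 5 + 66 * n) ≤
      (((p - k) / 2).choose k : ℝ) * boxProb k y (radius n p k) := by
  have hk := h.k_pos
  have hn := h.n_pos'
  have h1 := le_boxProb y (radius n p k) (by exact_mod_cast hk : 0 < k) h.radius_pos.le
  have h2 := h.sum_sq_le hy
  have h3 : Real.exp (99 - k * Real.log (p / k) / n) ≤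
      2 * radius n p k / √(2 * Real.pi * k) := by
    have hπ := Real.pi_pos
    have h4 : √(2 * Real.pi * k) = √(2 * Real.pi) * √k := Real.sqrt_mul (by positivity) _
    have h5 : √(2 * Real.pi) ≤ 4 := by
      rw [Real.sqrt_le_left (by norm_num)]
      linarith [Real.pi_le_four]
    have h6 : 2 ≤ Real.exp 1 := by linarith [Real.exp_one_gt_d9]
    have h7 : Real.exp (100 - k * Real.log (p / k) / n) =
        Real.exp 1 * Real.exp (99 - k * Real.log (p / k) / n) := by
      rw [← Real.exp_add]; congr 1; ring
    rw [h4, le_div_iff₀ (by positivity), radius, h7]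
    have h8 : 0 < Real.exp (99 - k * Real.log (p / k) / n) := Real.exp_pos _
    have h9 : 0 < √(k : ℝ) := by positivity
    calc _ = (Real.exp (99 - k * Real.log (p / k) / n) * √k) * √(2 * Real.pi) := by ring
      _ ≤ (Real.exp (99 - k * Real.log (p / k) / n) * √k) * (2 * Real.exp 1) := by
        gcongr; linarith
      _ = _ := by ring
  have h4 : Real.exp (99 * n - k * Real.log (p / k)) * Real.exp (-(66 * n + k / 10) / 2) ≤
      boxProb k y (radius n p k) := by
    refine le_trans ?_ h1
    have h5 : Real.exp (99 * n - k * Real.log (p / k)) =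
        Real.exp (99 - k * Real.log (p / k) / n) ^ n := by
      rw [← Real.exp_nat_mul]; congr 1; field_simp
    rw [h5]
    have := h.radius_pos
    gcongr
  calc Real.exp (k / 5 + 66 * n) = (Real.exp (k / 4) * Real.exp (k * Real.log (p / k))) *
        (Real.exp (99 * n - k * Real.log (p / k)) * Real.exp (-(66 * n + k / 10) / 2)) := by
        rw [← Real.exp_add, ← Real.exp_add, ← Real.exp_add]; congr 1; ring
    _ ≤ _ := mul_le_mul h.le_choose_half h4 (by positivity) (by positivity)

/-- If two supports of size `k` have at least `k (k / p) ^ (k / (2 n))` private elements each, the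
difference `X v - X w` is unlikely to be short. -/
lemma pairProb_le_exp (y : Fin n → ℝ) {l : ℕ} (hlk : l < k)
    (hl : k * Real.exp (-(k * Real.log (p / k) / n / 2)) ≤ (k : ℝ) - l) :
    pairProb k l y (radius n p k) ≤
      Real.exp (100 * n - 3 / 4 * (k * Real.log (p / k))) * boxProb k y (radius n p k) := by
  have hk := h.k_pos
  have hn := h.n_pos'
  set L := Real.log (p / k) with hLdef
  obtain ⟨m, hmr⟩ : ∃ m : ℝ, m = k - l := ⟨_, rfl⟩
  rw [← hmr] at hl
  have hm0 : 0 < m := lt_of_lt_of_le (by positivity) hl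
  set x := 2 * (k * L / n) with hx
  have hxn : x * n = 2 * (k * L) := by rw [hx]; field_simp
  have hmx : k * Real.exp (-(x / 4)) ≤ m := by
    refine le_trans (le_of_eq ?_) hl
    rw [hx]
    congr 3
    ring
  have h1 : 2 * radius n p k / √(2 * Real.pi * m) ≤ Real.exp (x / 8 + 100 - k * L / n) := by
    have hπ := Real.pi_gt_three
    have h2 : 2 * √m ≤ √(2 * Real.pi * m) := by
      refine Real.le_sqrt_of_sq_le ?_
      rw [mul_pow, Real.sq_sqrt hm0.le]
      nlinarith
    have h3 : √(k : ℝ) ≤ Real.exp (x / 8) * √m := by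
      rw [Real.sqrt_le_left (by positivity), mul_pow, Real.sq_sqrt hm0.le, ← Real.exp_nat_mul]
      have h4 : ((2 : ℕ) : ℝ) * (x / 8) = x / 4 := by push_cast; ring
      rw [h4]
      calc (k : ℝ) = Real.exp (x / 4) * (k * Real.exp (-(x / 4))) := by
            rw [mul_comm, mul_assoc, ← Real.exp_add]; simp
        _ ≤ _ := by gcongr
    have h5 : 0 < √m := Real.sqrt_pos.2 hm0
    calc 2 * radius n p k / √(2 * Real.pi * m) ≤ 2 * radius n p k / (2 * √m) := by
          have := h.radius_pos
          gcongr
      _ = √k / √m * Real.exp (100 - k * L / n) := by rw [radius, ← hLdef]; field_simp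
      _ ≤ Real.exp (x / 8) * Real.exp (100 - k * L / n) := by
          gcongr
          rwa [div_le_iff₀ h5]
      _ = _ := by rw [← Real.exp_add]; congr 1; ring
  refine (pairProb_le_mul y _ hlk h.radius_pos.le).trans ?_
  rw [← hmr]
  have h3 : Real.exp (100 * n - 3 / 4 * (k * L)) = Real.exp (x / 8 + 100 - k * L / n) ^ n := by
    rw [← Real.exp_nat_mul]
    congr 1
    have : (n : ℝ) * (x / 8 + 100 - k * L / n) = x * n / 8 + 100 * n - k * L := by field_simp
    rw [this, hxn]
    ring
  rw [h3]
  have := h.radius_pos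
  have := boxProb_nonneg y (radius n p k) k
  gcongr

/-- Pairs of supports with a large overlap contribute little to the second moment: if they differ
in very few columns there are few such pairs, otherwise the difference is unlikely to be short. -/
lemma near_term_le {y : Fin n → ℝ} (hy : ∑ i, y i ^ 2 ≤ 16 * k * (2 * n + k / 320)) {l : ℕ}
    (hl : k < 2 * l) (hlk : l ≤ k) :
    (k.choose l * ((p - k) / 2).choose (k - l) : ℝ) * pairProb k l y (radius n p k) /
        (((p - k) / 2).choose k * boxProb k y (radius n p k) ^ 2) ≤ Real.exp (-(k / 10)) := by
  have hk := h.k_pos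
  have hn := h.n_pos'
  have hL := h.le_log
  have hnL := h.n_le
  set q := boxProb k y (radius n p k) with hq
  set L := Real.log (p / k) with hLdef
  set N := (((p - k) / 2).choose k : ℝ) with hN
  have hEZ := h.le_expected hy
  rw [← hq, ← hN] at hEZ
  have hEZ0 : 0 < N * q := lt_of_lt_of_le (Real.exp_pos _) hEZ
  have hN0 : 0 < N := lt_of_lt_of_le (by positivity) h.le_choose_half
  have hq0 : 0 < q := (mul_pos_iff_of_pos_left hN0).1 hEZ0
  obtain ⟨m, hm⟩ : ∃ m, m = k - l := ⟨_, rfl⟩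
  have hmr : (m : ℝ) = k - l := by rw [hm, Nat.cast_sub hlk]
  have hm2 : (m : ℝ) ≤ k / 2 := by
    have : (k : ℝ) < 2 * l := by exact_mod_cast hl
    linarith
  have hcount : (k.choose l * ((p - k) / 2).choose (k - l) : ℝ) ≤
      Real.exp (m * L) * ((k : ℝ) ^ m / m.factorial) ^ 2 := by
    rw [← hm]
    have h1 : (k.choose l : ℝ) ≤ (k : ℝ) ^ m / m.factorial := by
      rw [← Nat.choose_symm hlk, ← hm]
      exact Nat.choose_le_pow_div m k
    have h2 : (((p - k) / 2).choose m : ℝ) ≤ Real.exp (m * L) * ((k : ℝ) ^ m / m.factorial) := by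
      refine le_trans ?_ (h.choose_le m)
      exact_mod_cast Nat.choose_le_choose m ((Nat.div_le_self _ _).trans (Nat.sub_le _ _))
    calc _ ≤ ((k : ℝ) ^ m / m.factorial) * (Real.exp (m * L) * ((k : ℝ) ^ m / m.factorial)) := by
          gcongr
      _ = _ := by ring
  have hp0 : 0 ≤ pairProb k l y (radius n p k) := ENNReal.toReal_nonneg
  have hA0 : (0 : ℝ) ≤ k.choose l * ((p - k) / 2).choose (k - l) := by positivity
  generalize (k.choose l * ((p - k) / 2).choose (k - l) : ℝ) = A at hcount hA0 ⊢
  set x := 2 * (k * L / n) with hx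
  have hx0 : 4000 ≤ x := by linarith [h.le_ratio]
  have hxn : x * n = 2 * (k * L) := by rw [hx]; field_simp
  rcases le_or_gt (m : ℝ) (k * Real.exp (-(x / 4))) with hmx | hmx
  · -- few pairs: the trivial bound on the joint probability suffices
    have h1 : x ^ 2 / 32 ≤ Real.exp (x / 4) := by
      have := Real.quadratic_le_exp_of_nonneg (by linarith : 0 ≤ x / 4)
      nlinarith
    have h2 : m * (x ^ 2 / 32) ≤ k := by
      calc m * (x ^ 2 / 32) ≤ (k * Real.exp (-(x / 4))) * Real.exp (x / 4) := by gcongr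
        _ = k := by rw [mul_assoc, ← Real.exp_add]; simp
    have hm0 : (0 : ℝ) ≤ m := Nat.cast_nonneg m
    have h3 : (m : ℝ) ≤ k / 1000 := by
      have h4 : (1000 : ℝ) ≤ x ^ 2 / 32 := by nlinarith
      have h5 := mul_le_mul_of_nonneg_left h4 hm0
      linarith
    have h4 : m * L ≤ n := by
      have h5 : m * x ≤ k := by nlinarith
      have h6 : m * L * k ≤ n * k := by
        have : m * L * k = m * x * n / 2 := by rw [mul_assoc (m : ℝ) x, hxn]; ring
        rw [this]
        nlinarith
      exact le_of_mul_le_mul_right h6 hk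
    have h5 : (k : ℝ) ^ m / m.factorial ≤ Real.exp (k / 40) :=
      (pow_div_factorial_mul_le k m).trans (Real.exp_le_exp.2 (by linarith))
    calc _ ≤ (Real.exp n * Real.exp (k / 40) ^ 2) * 1 / (N * q) := by
          refine mul_div_mul_sq_le (hcount.trans (by gcongr)) ?_ hp0 (by positivity) hN0 hq0
          rw [one_mul]
          exact pairProb_le y (radius n p k) hlk
      _ = (Real.exp n * Real.exp (k / 40) ^ 2) / (N * q) := by rw [mul_one]
      _ ≤ (Real.exp n * Real.exp (k / 40) ^ 2) / Real.exp (k / 5 + 66 * n) := by gcongr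
      _ = Real.exp (n + 2 * (k / 40) - (k / 5 + 66 * n)) := by
          rw [← Real.exp_nat_mul, ← Real.exp_add, ← Real.exp_sub]
          norm_num
      _ ≤ _ := Real.exp_le_exp.2 (by linarith)
  · -- the difference of the two supports is large enough to be penalized
    have hm0 : (0 : ℝ) < m := lt_trans (by positivity) hmx
    have hlk' : l < k := by
      have : 0 < m := by exact_mod_cast hm0
      omega
    have h2 : pairProb k l y (radius n p k) ≤ Real.exp (100 * n - 3 / 4 * (k * L)) * q := by
      refine h.pairProb_le_exp y hlk' ?_
      rw [← hmr]
      refine le_trans (le_of_eq ?_) hmx.le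
      rw [hx]
      congr 3
      ring
    have h3 : Real.exp (m * L) * ((k : ℝ) ^ m / m.factorial) ^ 2 ≤
        Real.exp (k * L / 2 + 2 * k) := by
      calc _ ≤ Real.exp (k * L / 2) * Real.exp k ^ 2 := by
            gcongr
            · nlinarith
            · exact pow_div_factorial_le k m
        _ = _ := by rw [← Real.exp_nat_mul, ← Real.exp_add]; norm_num
    calc _ ≤ Real.exp (k * L / 2 + 2 * k) * Real.exp (100 * n - 3 / 4 * (k * L)) / (N * q) :=
          mul_div_mul_sq_le (hcount.trans h3) h2 hp0 (Real.exp_pos _).le hN0 hq0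
      _ ≤ Real.exp (k * L / 2 + 2 * k) * Real.exp (100 * n - 3 / 4 * (k * L)) / 1 := by
          gcongr
          exact le_trans (Real.one_le_exp (by positivity)) hEZ
      _ = Real.exp (k * L / 2 + 2 * k + (100 * n - 3 / 4 * (k * L))) := by
          rw [div_one, ← Real.exp_add]
      _ ≤ _ := by
          refine Real.exp_le_exp.2 ?_
          nlinarith

end Regime

lemma choose_sub_mul_pow_le (N k l : ℕ) (hl : l ≤ k) (hk : k ≤ N) :
    (N.choose (k - l) : ℝ) * ((N : ℝ) - k) ^ l ≤ N.choose k * (k : ℝ) ^ l := by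
  have hNk : (0 : ℝ) ≤ (N : ℝ) - k := by
    have : (k : ℝ) ≤ N := by exact_mod_cast hk
    linarith
  induction l with
  | zero => simp
  | succ l ih =>
    have h1 := ih (by omega)
    obtain ⟨j, hj⟩ : ∃ j, k - l = j + 1 := ⟨k - l - 1, by omega⟩
    have hj' : k - (l + 1) = j := by omega
    rw [hj] at h1
    rw [hj']
    have h2 : (N.choose (j + 1) : ℝ) * (j + 1) = N.choose j * ((N : ℝ) - j) := by
      have h3 := Nat.choose_succ_right_eq N j
      have h4 : j ≤ N := by omega
      rw [← Nat.cast_sub h4]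
      exact_mod_cast h3
    have h3 : (j : ℝ) + 1 ≤ k := by exact_mod_cast (by omega : j + 1 ≤ k)
    have hC : (0 : ℝ) ≤ N.choose j := Nat.cast_nonneg _
    have hC1 : (0 : ℝ) ≤ N.choose (j + 1) := Nat.cast_nonneg _
    calc (N.choose j : ℝ) * ((N : ℝ) - k) ^ (l + 1)
        = (N.choose j * ((N : ℝ) - k)) * ((N : ℝ) - k) ^ l := by ring
      _ ≤ (N.choose (j + 1) * k) * ((N : ℝ) - k) ^ l := by
          gcongr ?_ * _
          calc (N.choose j : ℝ) * ((N : ℝ) - k) ≤ N.choose j * ((N : ℝ) - j) := by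
                gcongr; omega
            _ = N.choose (j + 1) * (j + 1) := h2.symm
            _ ≤ _ := by gcongr
      _ = (N.choose (j + 1) * ((N : ℝ) - k) ^ l) * k := by ring
      _ ≤ (N.choose k * (k : ℝ) ^ l) * k := by gcongr
      _ = _ := by ring

namespace Regime

variable {n p k : ℕ} (h : Regime n p k)
include h

/-- Pairs of supports with a small overlap `l`: there are at most a fraction `(4 k² / p) ^ l` of
them, and their correlation is too weak to compensate for that. -/
lemma far_term_le {y : Fin n → ℝ} (hy : ∑ i, y i ^ 2 ≤ 16 * k * (2 * n + k / 320)) {l : ℕ}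
    (hl0 : 0 < l) (hl : 2 * l ≤ k) :
    (k.choose l * ((p - k) / 2).choose (k - l) : ℝ) * pairProb k l y (radius n p k) /
        (((p - k) / 2).choose k * boxProb k y (radius n p k) ^ 2) ≤
      (8 * k ^ 2 / p * Real.exp (Real.log (p / k) / 20)) ^ l := by
  have hk := h.k_pos
  have hn := h.n_pos'
  have hp := h.p_pos
  have hnL := h.n_le
  set q := boxProb k y (radius n p k) with hq
  set L := Real.log (p / k) with hLdef
  set N := (((p - k) / 2).choose k : ℝ) with hN
  have hN0 : 0 < N := lt_of_lt_of_le (by positivity) h.le_choose_half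
  have hEZ := h.le_expected hy
  rw [← hq, ← hN] at hEZ
  have hEZ0 : 0 < N * q := lt_of_lt_of_le (Real.exp_pos _) hEZ
  have hq0 : 0 < q := (mul_pos_iff_of_pos_left hN0).1 hEZ0
  have hl0' : (0 : ℝ) < l := by exact_mod_cast hl0
  have hl' : 2 * (l : ℝ) ≤ k := by exact_mod_cast hl
  have hlk : (l : ℝ) < k := by linarith
  have h1 : k / √(((k : ℝ) - l) * (k + l)) ≤ Real.exp (l / k) := by
    have h2 : (0 : ℝ) < (k - l) * (k + l) := by
      have : (0 : ℝ) < (k : ℝ) - l := by linarith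
      positivity
    rw [div_le_iff₀ (Real.sqrt_pos.2 h2)]
    have h3 : (1 : ℝ) + l / k ≤ Real.exp (l / k) := by
      linarith [Real.add_one_le_exp ((l : ℝ) / k)]
    refine le_trans ?_ (mul_le_mul_of_nonneg_right h3 (Real.sqrt_nonneg _))
    rw [← Real.sqrt_sq (by positivity : (0 : ℝ) ≤ 1 + l / k), ← Real.sqrt_mul (by positivity)]
    refine Real.le_sqrt_of_sq_le ?_
    have h4 : (1 + (l : ℝ) / k) ^ 2 * ((k - l) * (k + l)) = (k + l) ^ 3 * (k - l) / k ^ 2 := by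
      field_simp
    rw [h4, le_div_iff₀ (by positivity)]
    -- the claim is `k ^ 4 ≤ (k + l) ^ 3 * (k - l)`, which holds since `2 * l ≤ k`
    have h5 : ((k : ℝ) + l) ^ 3 * (k - l) - k ^ 2 * k ^ 2 =
        l * (2 * k ^ 3 - 2 * k * l ^ 2 - l ^ 3) := by ring
    have h6 : (0 : ℝ) ≤ 2 * k ^ 3 - 2 * k * l ^ 2 - l ^ 3 := by
      have h7 : (l : ℝ) ^ 2 ≤ k ^ 2 / 4 := by nlinarith
      have h8 : (l : ℝ) ^ 3 ≤ k ^ 3 / 8 := by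
        calc (l : ℝ) ^ 3 ≤ (k / 2) ^ 3 := by gcongr; linarith
          _ = _ := by ring
      have h9 : 2 * (k : ℝ) * l ^ 2 ≤ 2 * k * (k ^ 2 / 4) := by gcongr
      have h10 : (0 : ℝ) < k ^ 3 := by positivity
      nlinarith
    nlinarith [mul_nonneg hl0'.le h6]
  have h2 : pairProb k l y (radius n p k) ≤ (2 * Real.exp (L / 20)) ^ l * q ^ 2 := by
    refine (pairProb_le_mul_sq y _ hl0 (by omega)).trans ?_
    rw [← hq]
    gcongr ?_ * _
    have h3 := h.sum_sq_le hy
    have h4 : Real.exp (1 / 10) ≤ 2 := by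
      have h5 : Real.exp (1 / 10) ≤ Real.exp (Real.log 2) :=
        Real.exp_le_exp.2 (by linarith [Real.log_two_gt_d9])
      rwa [Real.exp_log (by norm_num)] at h5
    calc _ ≤ Real.exp (l / k) ^ n * Real.exp (l / k * (66 * n + k / 10)) := by gcongr
      _ = Real.exp (l * (67 * n / k + 1 / 10)) := by
          rw [← Real.exp_nat_mul, ← Real.exp_add]
          congr 1
          field_simp
          ring
      _ ≤ Real.exp (l * (L / 20 + 1 / 10)) := by
          have h5 : 67 * (n : ℝ) / k ≤ L / 20 := by
            rw [div_le_iff₀ hk]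
            have : 0 ≤ L * k := by nlinarith [h.le_log]
            linarith
          gcongr
      _ = (Real.exp (1 / 10) * Real.exp (L / 20)) ^ l := by
          rw [← Real.exp_add, ← Real.exp_nat_mul]
          congr 1
          ring
      _ ≤ _ := by gcongr
  have h3 : (k.choose l * ((p - k) / 2).choose (k - l) : ℝ) ≤ (4 * k ^ 2 / p) ^ l * N := by
    have h4 : (k.choose l : ℝ) ≤ (k : ℝ) ^ l := by exact_mod_cast Nat.choose_le_pow k l
    have h5 := choose_sub_mul_pow_le ((p - k) / 2) k l (by omega) h.le_half
    rw [← hN] at h5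
    have h6 : ((p : ℝ) / 4) ^ l ≤ (((p - k) / 2 : ℕ) - (k : ℝ)) ^ l :=
      pow_le_pow_left₀ (by positivity) h.half_sub_le l
    have h7 : (((p - k) / 2).choose (k - l) : ℝ) * (p / 4) ^ l ≤ N * k ^ l :=
      le_trans (by gcongr) h5
    have h8 : (((p - k) / 2).choose (k - l) : ℝ) ≤ N * k ^ l / (p / 4) ^ l := by
      rwa [le_div_iff₀ (by positivity)]
    calc _ ≤ (k : ℝ) ^ l * (N * k ^ l / (p / 4) ^ l) := by gcongr
      _ = _ := by
        rw [div_pow, div_pow, mul_pow, ← pow_mul, mul_comm 2 l, pow_mul, sq]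
        field_simp
  have hp0 : 0 ≤ pairProb k l y (radius n p k) := ENNReal.toReal_nonneg
  calc _ ≤ (4 * k ^ 2 / p) ^ l * N * ((2 * Real.exp (L / 20)) ^ l * q ^ 2) / (N * q ^ 2) := by
        gcongr
    _ = (4 * k ^ 2 / p) ^ l * (2 * Real.exp (L / 20)) ^ l := by field_simp
    _ = _ := by rw [← mul_pow]; congr 1; ring

/-- For a typical target, a solution exists in any set of `(p - k) / 2` columns with high
probability. -/
lemma real_forall_notMem_le {ι : Type*} [Fintype ι] [DecidableEq ι] {S : Finset ι}
    (hS : S.card = (p - k) / 2) {y : Fin n → ℝ}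
    (hy : ∑ i, y i ^ 2 ≤ 16 * k * (2 * n + k / 320))
    (ha : 8 * k ^ 2 / p * Real.exp (Real.log (p / k) / 20) ≤ 1 / 2) :
    (matGauss n ι).real {X | ∀ v ∈ S.powersetCard k, X ∉ matBox v y (radius n p k)} ≤
      2 * (8 * k ^ 2 / p * Real.exp (Real.log (p / k) / 20)) + k * Real.exp (-(k / 10)) := by
  have hEZ := h.le_expected hy
  have hN0 : 0 < (((p - k) / 2).choose k : ℝ) := lt_of_lt_of_le (by positivity) h.le_choose_half
  have hq0 : 0 < boxProb k y (radius n p k) :=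
    (mul_pos_iff_of_pos_left hN0).1 (lt_of_lt_of_le (Real.exp_pos _) hEZ)
  set a := 8 * k ^ 2 / p * Real.exp (Real.log (p / k) / 20) with ha'
  have ha0 : 0 ≤ a := by positivity
  refine (real_forall_notMem_matBox_le S (hS ▸ h.le_half) y _ hq0).trans ?_
  rw [hS]
  calc _ ≤ ∑ l ∈ Finset.Icc 1 k, (a ^ l + Real.exp (-(k / 10))) := by
        refine Finset.sum_le_sum fun l hl => ?_
        rw [Finset.mem_Icc] at hl
        rcases le_or_gt (2 * l) k with hlk | hlk
        · exact (h.far_term_le hy hl.1 hlk).trans (le_add_of_nonneg_right (Real.exp_pos _).le)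
        · exact (h.near_term_le hy hlk hl.2).trans (le_add_of_nonneg_left (by positivity))
    _ = ∑ l ∈ Finset.Icc 1 k, a ^ l + k * Real.exp (-(k / 10)) := by
        rw [Finset.sum_add_distrib]
        simp
    _ ≤ _ := by
        gcongr
        have h1 : ∀ j, ∑ l ∈ Finset.Icc 1 j, a ^ l ≤ 2 * a * (1 - (1 / 2) ^ j) := fun j => by
          induction j with
          | zero => simp
          | succ j ih =>
            rw [Finset.sum_Icc_succ_top (by omega)]
            have h2 : a ^ (j + 1) ≤ a * (1 / 2) ^ j := by
              rw [pow_succ, mul_comm]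
              gcongr
            calc _ ≤ 2 * a * (1 - (1 / 2) ^ j) + a * (1 / 2) ^ j := add_le_add ih h2
              _ = _ := by ring
        refine (h1 k).trans ?_
        have : 0 ≤ (1 / 2 : ℝ) ^ k := by positivity
        nlinarith

/-- With high probability no low-energy support away from the hidden one has a low-energy support
at distance `k / 2`. -/
lemma matGauss_exists_pair_le {ι : Type*} [Fintype ι] [DecidableEq ι]
    (hp : Fintype.card ι = p) (u : Finset ι) (w : Fin n → ℝ) :
    matGauss n ι {X | ∃ v₀ ∈ (uᶜ).powersetCard k, ∃ v ∈ Finset.univ.powersetCard k,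
        (v₀ \ v).card = k / 2 ∧
        ∑ i, (colSum X u i + w i - colSum X v₀ i) ^ 2 ≤ n * radius n p k ^ 2 ∧
        ∑ i, (colSum X v i - colSum X v₀ i) ^ 2 ≤ 9 * n * radius n p k ^ 2} ≤
      ENNReal.ofReal (Real.exp (-(k * Real.log (p / k) / 4))) := by
  have hk := h.k_pos
  have hn := h.n_pos'
  have hr := h.radius_pos
  have hk2 := h.two_le_k
  have hL := h.le_log
  have hnL := h.n_le
  set r := radius n p k with hrdef
  set L := Real.log (p / k) with hLdef
  set m := k / 2 with hm
  have hm0 : 0 < m := by omega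
  have hmk : m < k := by omega
  have hm3 : (k : ℝ) ≤ 3 * m := by exact_mod_cast (by omega : k ≤ 3 * m)
  have hm2 : 2 * (m : ℝ) ≤ k := by exact_mod_cast (by omega : 2 * m ≤ k)
  set B : ℝ := Real.exp (204 * n - 2 * (k * L)) with hB
  have hpair : ∀ v₀ ∈ (uᶜ).powersetCard k, ∀ v : Finset ι, (v₀ \ v).card = m →
      matGauss n ι {X | ∑ i, (colSum X u i + w i - colSum X v₀ i) ^ 2 ≤ n * r ^ 2 ∧
        ∑ i, (colSum X v i - colSum X v₀ i) ^ 2 ≤ 9 * n * r ^ 2} ≤ ENNReal.ofReal B := by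
    intro v₀ hv₀ v hv
    rw [Finset.mem_powersetCard] at hv₀
    have hd : Disjoint v₀ u := by
      rw [Finset.disjoint_left]
      intro j hj
      simpa using hv₀.1 hj
    refine (matGauss_pair_le hv₀.2 hd hv hm0 hmk (s₁ := 1 / r ^ 2) (s₂ := 1 / (9 * r ^ 2))
      (by positivity) (by positivity) w).trans (ENNReal.ofReal_le_ofReal ?_)
    have h1 : (1 / r ^ 2 * (n * r ^ 2) + 1 / (9 * r ^ 2) * (9 * n * r ^ 2)) / 2 = n := by
      field_simp
      ring
    have hkm : (k : ℝ) / 2 ≤ (k : ℝ) - m := by linarith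
    have h2 : 1 / √(1 / r ^ 2 * ((k : ℝ) - m)) * (1 / √(1 / (9 * r ^ 2) * m)) ≤
        Real.exp (203 - 2 * (k * L / n)) := by
      have h3 : k / (8 * r ^ 2) ≤ √(1 / r ^ 2 * ((k : ℝ) - m)) * √(1 / (9 * r ^ 2) * m) := by
        rw [← Real.sqrt_mul (mul_nonneg (by positivity) (by linarith))]
        refine Real.le_sqrt_of_sq_le ?_
        have h4 : 1 / r ^ 2 * ((k : ℝ) - m) * (1 / (9 * r ^ 2) * m) =
            ((k : ℝ) - m) * m / (9 * r ^ 4) := by field_simp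
        rw [h4, div_pow, div_le_div_iff₀ (by positivity) (by positivity)]
        have h5 : (k : ℝ) ^ 2 ≤ 6 * (((k : ℝ) - m) * m) := by nlinarith
        have h6 : 0 < r ^ 4 := by positivity
        nlinarith [mul_le_mul_of_nonneg_right h5 h6.le]
      have h5 : 8 * r ^ 2 / k ≤ Real.exp (203 - 2 * (k * L / n)) := by
        rw [hrdef, h.radius_sq, ← hLdef]
        have h6 : (8 : ℝ) ≤ Real.exp 3 := by
          have h7 : Real.exp 3 = Real.exp 1 ^ 3 := by rw [← Real.exp_nat_mul]; norm_num
          rw [h7]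
          calc (8 : ℝ) = 2 ^ 3 := by norm_num
            _ ≤ _ := by gcongr; linarith [Real.exp_one_gt_d9]
        calc _ = 8 * Real.exp (200 - 2 * (k * L / n)) := by field_simp
          _ ≤ Real.exp 3 * Real.exp (200 - 2 * (k * L / n)) := by gcongr
          _ = _ := by rw [← Real.exp_add]; congr 1; ring
      refine le_trans ?_ h5
      rw [div_mul_div_comm, one_mul]
      have h6 : 8 * r ^ 2 / k = 1 / (k / (8 * r ^ 2)) := by field_simp
      rw [h6]
      exact one_div_le_one_div_of_le (by positivity) h3
    rw [h1]
    calc _ ≤ Real.exp n * Real.exp (203 - 2 * (k * L / n)) ^ n := by gcongr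
      _ = B := by
        rw [← Real.exp_nat_mul, ← Real.exp_add, hB]
        congr 1
        field_simp
        ring
  have hsub : {X : Fin n → ι → ℝ | ∃ v₀ ∈ (uᶜ).powersetCard k, ∃ v ∈ Finset.univ.powersetCard k,
        (v₀ \ v).card = m ∧ ∑ i, (colSum X u i + w i - colSum X v₀ i) ^ 2 ≤ n * r ^ 2 ∧
        ∑ i, (colSum X v i - colSum X v₀ i) ^ 2 ≤ 9 * n * r ^ 2} ⊆
      ⋃ v₀ ∈ (uᶜ).powersetCard k, ⋃ v ∈ (Finset.univ.powersetCard k).filter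
        (fun v => (v₀ ∩ v).card = k - m),
        {X | ∑ i, (colSum X u i + w i - colSum X v₀ i) ^ 2 ≤ n * r ^ 2 ∧
          ∑ i, (colSum X v i - colSum X v₀ i) ^ 2 ≤ 9 * n * r ^ 2} := by
    rintro X ⟨v₀, hv₀, v, hv, hvm, hX⟩
    simp only [Set.mem_iUnion]
    refine ⟨v₀, hv₀, v, Finset.mem_filter.2 ⟨hv, ?_⟩, hX⟩
    have := Finset.card_inter_add_card_sdiff v₀ v
    rw [(Finset.mem_powersetCard.1 hv₀).2] at this
    omega
  refine (measure_mono hsub).trans ?_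
  refine (measure_biUnion_finset_le _ _).trans ?_
  calc _ ≤ ∑ v₀ ∈ (uᶜ).powersetCard k, ((k.choose m * p.choose m : ℕ) : ℝ≥0∞) *
        ENNReal.ofReal B := by
        refine Finset.sum_le_sum fun v₀ hv₀ => ?_
        refine (measure_biUnion_finset_le _ _).trans ?_
        have hv₀k := (Finset.mem_powersetCard.1 hv₀).2
        calc _ ≤ ∑ v ∈ (Finset.univ.powersetCard k).filter
              (fun v => (v₀ ∩ v).card = k - m), ENNReal.ofReal B := by
              refine Finset.sum_le_sum fun v hv => hpair v₀ hv₀ v ?_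
              have := Finset.card_inter_add_card_sdiff v₀ v
              have := (Finset.mem_filter.1 hv).2
              omega
          _ ≤ _ := by
              rw [Finset.sum_const, nsmul_eq_mul]
              gcongr
              have h1 := card_filter_inter_le Finset.univ v₀ (l := k - m) hv₀k
              rwa [Finset.card_univ, hp, Nat.sub_sub_self hmk.le, Nat.choose_symm hmk.le] at h1
    _ ≤ ((p.choose k : ℕ) : ℝ≥0∞) * (((k.choose m * p.choose m : ℕ) : ℝ≥0∞) *
        ENNReal.ofReal B) := by
        rw [Finset.sum_const, nsmul_eq_mul, Finset.card_powersetCard]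
        gcongr
        rw [← hp, ← Finset.card_univ]
        exact Finset.card_le_card (Finset.subset_univ _)
    _ = ENNReal.ofReal (p.choose k * (k.choose m * p.choose m * B)) := by
        rw [ENNReal.ofReal_mul (by positivity), ENNReal.ofReal_mul (by positivity),
          ENNReal.ofReal_natCast, ← Nat.cast_mul, ENNReal.ofReal_natCast]
    _ ≤ _ := by
        refine ENNReal.ofReal_le_ofReal ?_
        have h1 : (k.choose m : ℝ) ≤ Real.exp k :=
          (Nat.choose_le_pow_div m k).trans (pow_div_factorial_le k m)
        calc _ ≤ Real.exp (k * L + k) * (Real.exp k * Real.exp (m * L + k) * B) := by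
              gcongr
              · exact h.choose_le' k
              · exact h.choose_le' m
          _ = Real.exp (k * L + k + (k + (m * L + k) + (204 * n - 2 * (k * L)))) := by
              rw [hB, ← Real.exp_add, ← Real.exp_add, ← Real.exp_add]
          _ ≤ _ := by
              refine Real.exp_le_exp.2 ?_
              have h2 : (m : ℝ) * L ≤ k / 2 * L := by gcongr; linarith
              have h3 : 40 * (k : ℝ) ≤ k * L := by nlinarith
              linarith

end Regime

/-! ### From good designs to slow chains -/

lemma mulVec_toVec {n p k : ℕ} (X : Fin n → Fin p → ℝ) (v : SparseVec p k) :
    Matrix.of X *ᵥ v.toVec = colSum X v.1 := by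
  ext i
  simp [Matrix.mulVec, dotProduct, SparseVec.toVec, colSum]

lemma hamiltonian_response {n p k : ℕ} (X : Fin n → Fin p → ℝ) (W : Fin n → ℝ)
    (u v : SparseVec p k) :
    hamiltonian X (response X W u) v =
      -∑ i, (colSum X u.1 i + W i - colSum X v.1 i) ^ 2 := by
  simp only [hamiltonian, response, mulVec_toVec, Pi.add_apply]

lemma sum_sq_le_of_mem_matBox {n : ℕ} {ι : Type*} {X : Fin n → ι → ℝ} {v : Finset ι}
    {y : Fin n → ℝ} {δ : ℝ} (hX : X ∈ matBox v y δ) :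
    ∑ i, (y i - colSum X v i) ^ 2 ≤ n * δ ^ 2 := by
  calc ∑ i, (y i - colSum X v i) ^ 2 ≤ ∑ _i : Fin n, δ ^ 2 := by
        refine Finset.sum_le_sum fun i _ => ?_
        have h := hX i
        simp only [rowBox, Set.mem_ofPred_eq, Set.mem_Icc] at h
        refine sq_le_sq' ?_ ?_ <;> simp only [colSum] <;> linarith [h.1, h.2]
    _ = _ := by simp

/-- The designs for which the response is too long, or one of the two halves `S₁`, `S₂` of the
columns contains no solution, or a low-energy support has a low-energy support at distance
`k / 2`. -/
def badSet (n p k : ℕ) (u S₁ S₂ : Finset (Fin p)) :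
    Set ((Fin n → Fin p → ℝ) × (Fin n → ℝ)) :=
  {z | 16 * k * (2 * n + k / 320) < ∑ i, (colSum z.1 u i + z.2 i) ^ 2} ∪
  {z | ∑ i, (colSum z.1 u + z.2) i ^ 2 ≤ 16 * k * (2 * n + (k : ℝ) / 320) ∧
    ∀ v ∈ S₁.powersetCard k, z.1 ∉ matBox v (colSum z.1 u + z.2) (radius n p k)} ∪
  {z | ∑ i, (colSum z.1 u + z.2) i ^ 2 ≤ 16 * k * (2 * n + (k : ℝ) / 320) ∧
    ∀ v ∈ S₂.powersetCard k, z.1 ∉ matBox v (colSum z.1 u + z.2) (radius n p k)} ∪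
  {z | ∃ v₀ ∈ (uᶜ).powersetCard k, ∃ v ∈ Finset.univ.powersetCard k, (v₀ \ v).card = k / 2 ∧
    ∑ i, (colSum z.1 u i + z.2 i - colSum z.1 v₀ i) ^ 2 ≤ n * radius n p k ^ 2 ∧
    ∑ i, (colSum z.1 v i - colSum z.1 v₀ i) ^ 2 ≤ 9 * n * radius n p k ^ 2}

lemma mem_allChainsSlow_of_notMem_badSet {n p k : ℕ} {β T : ℝ} (hβ : 0 ≤ β) (hT0 : 0 ≤ T)
    (hk : 0 < k) (hT : 4 * T * p.choose k ≤ Real.exp (β * (3 * n * radius n p k ^ 2)))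
    (d : (Fin n → Fin p → ℝ) × (Fin n → ℝ) × SparseVec p k) {S₁ S₂ : Finset (Fin p)}
    (h₁ : S₁ ⊆ d.2.2.1ᶜ) (h₁₂ : Disjoint S₁ S₂)
    (hd : (d.1, d.2.1) ∉ badSet n p k d.2.2.1 S₁ S₂) : d ∈ allChainsSlow n p k β T := by
  obtain ⟨X, W, u⟩ := d
  simp only at h₁ hd ⊢
  set r := radius n p k with hr
  simp only [badSet, Set.mem_union, Set.mem_ofPred_eq, not_or, not_lt, not_and, not_forall,
    not_not, exists_prop] at hd
  obtain ⟨⟨⟨hy, hS₁⟩, hS₂⟩, hpair⟩ := hd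
  obtain ⟨v₀, hv₀, hb₀⟩ := hS₁ hy
  obtain ⟨v₁, hv₁, hb₁⟩ := hS₂ hy
  rw [Finset.mem_powersetCard] at hv₀ hv₁
  have he₀ := sum_sq_le_of_mem_matBox hb₀
  have he₁ := sum_sq_le_of_mem_matBox hb₁
  simp only [Pi.add_apply] at he₀ he₁
  refine mem_allChainsSlow_of_shell (E₀ := n * r ^ 2) (E₁ := 4 * (n * r ^ 2)) hβ (k / 2) (X, W, u)
    ⟨v₀, hv₀.2⟩ ⟨v₁, hv₁.2⟩ ?_ ?_ ?_ ?_ ?_ hT0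
  · rw [hamiltonian_response]
    exact neg_le_neg he₀
  · rw [hamiltonian_response]
    exact neg_le_neg he₁
  · have hdis : Disjoint v₀ v₁ := h₁₂.mono hv₀.1 hv₁.1
    simp only
    rw [hdis.sdiff_eq_left, hv₀.2]
    omega
  · intro v hv
    rw [hamiltonian_response]
    by_contra hlt
    push Not at hlt
    refine hpair ⟨v₀, Finset.mem_powersetCard.2 ⟨hv₀.1.trans h₁, hv₀.2⟩, v.1,
      Finset.mem_powersetCard.2 ⟨Finset.subset_univ _, v.2⟩, hv, he₀, ?_⟩
    -- `(a - b)² ≤ 3 a² + (3 / 2) b²`, applied to the residuals of `v₀` and `v`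
    have h1 : ∑ i, (colSum X v.1 i - colSum X v₀ i) ^ 2 ≤
        3 * ∑ i, (colSum X u.1 i + W i - colSum X v₀ i) ^ 2 +
          3 / 2 * ∑ i, (colSum X u.1 i + W i - colSum X v.1 i) ^ 2 := by
      rw [Finset.mul_sum, Finset.mul_sum, ← Finset.sum_add_distrib]
      refine Finset.sum_le_sum fun i _ => ?_
      nlinarith [sq_nonneg (2 * (colSum X u.1 i + W i - colSum X v₀ i) +
        (colSum X u.1 i + W i - colSum X v.1 i))]
    linarith
  · refine hT.trans (le_of_eq ?_)
    congr 1
    ring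

lemma measurable_colSum_add {n p : ℕ} (u : Finset (Fin p)) :
    Measurable fun z : (Fin n → Fin p → ℝ) × (Fin n → ℝ) => colSum z.1 u + z.2 :=
  ((measurable_colSum u).comp measurable_fst).add measurable_snd

lemma measurableSet_noSolution (n p k : ℕ) (u S : Finset (Fin p)) (R δ : ℝ) :
    MeasurableSet {z : (Fin n → Fin p → ℝ) × (Fin n → ℝ) |
      ∑ i, (colSum z.1 u + z.2) i ^ 2 ≤ R ∧
        ∀ v ∈ S.powersetCard k, z.1 ∉ matBox v (colSum z.1 u + z.2) δ} := by
  have hc := measurable_colSum_add (n := n) u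
  have h1 : Measurable fun z : (Fin n → Fin p → ℝ) × (Fin n → ℝ) =>
      ∑ i, (colSum z.1 u + z.2) i ^ 2 :=
    (by fun_prop : Measurable fun y : Fin n → ℝ => ∑ i, y i ^ 2).comp hc
  have h2 : {z : (Fin n → Fin p → ℝ) × (Fin n → ℝ) |
      ∑ i, (colSum z.1 u + z.2) i ^ 2 ≤ R ∧
        ∀ v ∈ S.powersetCard k, z.1 ∉ matBox v (colSum z.1 u + z.2) δ} =
      {z | ∑ i, (colSum z.1 u + z.2) i ^ 2 ≤ R} ∩ ⋂ v ∈ S.powersetCard k,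
        (fun z => (z.1, colSum z.1 u + z.2)) ⁻¹' {z | z.1 ∈ matBox v z.2 δ}ᶜ := by
    ext z; simp
  rw [h2]
  refine (measurableSet_le h1 measurable_const).inter
    (Finset.measurableSet_biInter _ fun v _ => ?_)
  exact (measurableSet_setOf_mem_matBox v δ).compl.preimage (measurable_fst.prodMk hc)

lemma measurableSet_exists_pair (n p k : ℕ) (u : Finset (Fin p)) (R R' : ℝ) :
    MeasurableSet {z : (Fin n → Fin p → ℝ) × (Fin n → ℝ) | ∃ v₀ ∈ (uᶜ).powersetCard k,
      ∃ v ∈ Finset.univ.powersetCard k, (v₀ \ v).card = k / 2 ∧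
      ∑ i, (colSum z.1 u i + z.2 i - colSum z.1 v₀ i) ^ 2 ≤ R ∧
      ∑ i, (colSum z.1 v i - colSum z.1 v₀ i) ^ 2 ≤ R'} := by
  have h1 : ∀ (v₀ v : Finset (Fin p)), MeasurableSet {z : (Fin n → Fin p → ℝ) × (Fin n → ℝ) |
      ∑ i, (colSum z.1 u i + z.2 i - colSum z.1 v₀ i) ^ 2 ≤ R ∧
      ∑ i, (colSum z.1 v i - colSum z.1 v₀ i) ^ 2 ≤ R'} := fun v₀ v => by
    have h : ∀ (a b : (Fin n → Fin p → ℝ) × (Fin n → ℝ) → Fin n → ℝ) (r : ℝ), Measurable a →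
        Measurable b → MeasurableSet {X | ∑ i, (a X i - b X i) ^ 2 ≤ r} := fun a b r ha hb =>
      measurableSet_le (by fun_prop) measurable_const
    have hcol : ∀ v : Finset (Fin p), Measurable fun z : (Fin n → Fin p → ℝ) × (Fin n → ℝ) =>
      colSum z.1 v := fun v => (measurable_colSum v).comp measurable_fst
    exact (h _ _ R (measurable_colSum_add u) (hcol v₀)).inter (h _ _ R' (hcol v) (hcol v₀))
  have h2 : {z : (Fin n → Fin p → ℝ) × (Fin n → ℝ) | ∃ v₀ ∈ (uᶜ).powersetCard k,
      ∃ v ∈ Finset.univ.powersetCard k, (v₀ \ v).card = k / 2 ∧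
      ∑ i, (colSum z.1 u i + z.2 i - colSum z.1 v₀ i) ^ 2 ≤ R ∧
      ∑ i, (colSum z.1 v i - colSum z.1 v₀ i) ^ 2 ≤ R'} =
      ⋃ v₀ ∈ (uᶜ).powersetCard k, ⋃ v ∈ (Finset.univ.powersetCard k).filter
        (fun v => (v₀ \ v).card = k / 2),
        {z | ∑ i, (colSum z.1 u i + z.2 i - colSum z.1 v₀ i) ^ 2 ≤ R ∧
          ∑ i, (colSum z.1 v i - colSum z.1 v₀ i) ^ 2 ≤ R'} := by
    ext z
    simp only [Set.mem_ofPred_eq, Set.mem_iUnion, exists_prop, Finset.mem_filter, and_assoc]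
  rw [h2]
  exact Finset.measurableSet_biUnion _ fun v₀ _ => Finset.measurableSet_biUnion _ fun v _ => h1 v₀ v

lemma measurableSet_long_response (n p : ℕ) (u : Finset (Fin p)) (R : ℝ) :
    MeasurableSet {z : (Fin n → Fin p → ℝ) × (Fin n → ℝ) |
      R < ∑ i, (colSum z.1 u i + z.2 i) ^ 2} :=
  measurableSet_lt measurable_const
    ((by fun_prop : Measurable fun y : Fin n → ℝ => ∑ i, y i ^ 2).comp (measurable_colSum_add u))

lemma measurableSet_badSet (n p k : ℕ) (u S₁ S₂ : Finset (Fin p)) :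
    MeasurableSet (badSet n p k u S₁ S₂) :=
  (((measurableSet_long_response n p u _).union (measurableSet_noSolution n p k u S₁ _ _)).union
    (measurableSet_noSolution n p k u S₂ _ _)).union (measurableSet_exists_pair n p k u _ _)

lemma prod_measure_le_of_section_le {α β : Type*} [MeasurableSpace α] [MeasurableSpace β]
    (μ : Measure α) (ν : Measure β) [IsProbabilityMeasure μ] [IsProbabilityMeasure ν]
    {s : Set (α × β)} (hs : MeasurableSet s) {ε : ℝ≥0∞} (h : ∀ b, μ {a | (a, b) ∈ s} ≤ ε) :
    μ.prod ν s ≤ ε := by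
  rw [Measure.prod_apply_symm hs]
  refine (lintegral_mono h).trans ?_
  simp

lemma dataLaw_le {n p k : ℕ} {σsq : ℝ≥0} (hk : k ≤ p)
    (B : SparseVec p k → Set ((Fin n → Fin p → ℝ) × (Fin n → ℝ)))
    (hB : ∀ v, MeasurableSet (B v)) {ε : ℝ≥0∞}
    (h : ∀ v, (matGauss n (Fin p)).prod (Measure.pi fun _ => gaussianReal 0 σsq) (B v) ≤ ε) :
    dataLaw n p k σsq {d | (d.1, d.2.1) ∈ B d.2.2} ≤ ε := by
  have : Nonempty (SparseVec p k) := by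
    obtain ⟨s, -, hs⟩ := Finset.exists_subset_card_eq (s := (Finset.univ : Finset (Fin p)))
      (by simpa using hk)
    exact ⟨⟨s, hs⟩⟩
  have hmp := measurePreserving_prodAssoc (matGauss n (Fin p))
    (Measure.pi fun _ : Fin n => gaussianReal 0 σsq)
    (uniformOn (Set.univ : Set (SparseVec p k)))
  have hA : MeasurableSet {z : ((Fin n → Fin p → ℝ) × (Fin n → ℝ)) × SparseVec p k |
      z.1 ∈ B z.2} := by
    have : {z : ((Fin n → Fin p → ℝ) × (Fin n → ℝ)) × SparseVec p k | z.1 ∈ B z.2} =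
        ⋃ v, B v ×ˢ {v} := by
      ext z; simp
    rw [this]
    exact MeasurableSet.iUnion fun v => (hB v).prod (measurableSet_singleton v)
  unfold dataLaw
  rw [← hmp.measure_preimage_equiv]
  exact prod_measure_le_of_section_le _ _ hA h

/-- An upper bound for the probability of a bad design, which depends on the sparsity only. -/
def failureBound (k : ℕ) : ℝ :=
  Real.exp (-(k / 320)) + 2 * (16 / √k + k * Real.exp (-(k / 10))) + Real.exp (-k)

lemma tendsto_failureBound : Tendsto failureBound atTop (𝓝 0) := by
  have hcast : Tendsto (fun k : ℕ => (k : ℝ)) atTop atTop := tendsto_natCast_atTop_atTop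
  have h1 : ∀ c : ℝ, 0 < c → Tendsto (fun k : ℕ => Real.exp (-((k : ℝ) / c))) atTop (𝓝 0) :=
    fun c hc => Real.tendsto_exp_neg_atTop_nhds_zero.comp (hcast.atTop_div_const hc)
  have h2 : Tendsto (fun k : ℕ => 16 / √(k : ℝ)) atTop (𝓝 0) :=
    (Real.tendsto_sqrt_atTop.comp hcast).const_div_atTop 16
  have h3 : Tendsto (fun k : ℕ => (k : ℝ) * Real.exp (-(k / 10))) atTop (𝓝 0) := by
    have h4 := (Real.tendsto_pow_mul_exp_neg_atTop_nhds_zero 1).comp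
      (hcast.atTop_div_const (by norm_num : (0 : ℝ) < 10))
    have h5 := h4.const_mul 10
    rw [mul_zero] at h5
    refine h5.congr fun k => ?_
    simp only [Function.comp, pow_one]
    ring
  have h6 : Tendsto (fun k : ℕ => Real.exp (-(k : ℝ))) atTop (𝓝 0) :=
    Real.tendsto_exp_neg_atTop_nhds_zero.comp hcast
  have h7 := ((h1 320 (by norm_num)).add ((h2.add h3).const_mul 2)).add h6
  simp only [add_zero, mul_zero] at h7
  exact h7

lemma Regime.measure_badSet_le {n p k : ℕ} (h : Regime n p k) {σsq : ℝ≥0} (hσ0 : σsq ≠ 0)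
    (hσ : (σsq : ℝ) ≤ k) (hcube : k ^ 3 ≤ p) (hk : 1024 ≤ k) {u S₁ S₂ : Finset (Fin p)}
    (hu : u.card = k) (h₁ : S₁ ⊆ uᶜ) (h₂ : S₂ ⊆ uᶜ) (hc₁ : S₁.card = (p - k) / 2)
    (hc₂ : S₂.card = (p - k) / 2) :
    (matGauss n (Fin p)).prod (Measure.pi fun _ => gaussianReal 0 σsq) (badSet n p k u S₁ S₂) ≤
      ENNReal.ofReal (failureBound k) := by
  have hk0 := h.k_pos
  have hp0 := h.p_pos
  have hL := h.le_log
  have hcube' : (k : ℝ) ^ 3 ≤ p := by exact_mod_cast hcube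
  have hk' : (1024 : ℝ) ≤ k := by exact_mod_cast hk
  have hsq : 32 ≤ √(k : ℝ) := Real.le_sqrt_of_sq_le (by norm_num; exact hk)
  set a := 8 * k ^ 2 / p * Real.exp (Real.log (p / k) / 20) with ha
  have ha8 : a ≤ 8 / √k := by
    have hlog : 2 * Real.log k ≤ Real.log (p / k) := by
      have : 2 * Real.log k = Real.log ((k : ℝ) ^ 2) := by rw [Real.log_pow]; norm_num
      rw [this]
      refine Real.log_le_log (by positivity) ?_
      rw [le_div_iff₀ hk0]
      calc (k : ℝ) ^ 2 * k = k ^ 3 := by ring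
        _ ≤ (p : ℝ) := hcube'
    have hkexp : (k : ℝ) ≤ Real.exp (Real.log (p / k) / 2) := by
      calc (k : ℝ) = Real.exp (Real.log k) := (Real.exp_log hk0).symm
        _ ≤ _ := Real.exp_le_exp.2 (by linarith)
    have hsk : √(k : ℝ) ≤ Real.exp (Real.log (p / k) / 4) := by
      rw [Real.sqrt_le_left (Real.exp_pos _).le, ← Real.exp_nat_mul]
      refine hkexp.trans (le_of_eq ?_)
      congr 1
      push_cast
      ring
    have hkp : (k : ℝ) / p = Real.exp (-Real.log (p / k)) := by
      rw [Real.exp_neg, h.exp_log, inv_div]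
    rw [le_div_iff₀ (by linarith)]
    calc a * √k = 8 * k * (k / p) * Real.exp (Real.log (p / k) / 20) * √k := by
          rw [ha]; ring
      _ ≤ 8 * Real.exp (Real.log (p / k) / 2) * Real.exp (-Real.log (p / k)) *
          Real.exp (Real.log (p / k) / 20) * Real.exp (Real.log (p / k) / 4) := by
          rw [hkp]
          gcongr
      _ = 8 * Real.exp (Real.log (p / k) / 2 + -Real.log (p / k) + Real.log (p / k) / 20 +
          Real.log (p / k) / 4) := by
          rw [Real.exp_add, Real.exp_add, Real.exp_add]
          ring
      _ ≤ 8 * 1 := by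
          gcongr
          rw [Real.exp_le_one_iff]
          linarith
      _ = 8 := by ring
  have ha2 : a ≤ 1 / 2 := by
    refine ha8.trans ?_
    rw [div_le_div_iff₀ (by linarith) (by norm_num)]
    linarith
  have hno : ∀ S ⊆ uᶜ, S.card = (p - k) / 2 →
      (matGauss n (Fin p)).prod (Measure.pi fun _ => gaussianReal 0 σsq)
        {z | ∑ i, (colSum z.1 u + z.2) i ^ 2 ≤ 16 * k * (2 * n + (k : ℝ) / 320) ∧
          ∀ v ∈ S.powersetCard k, z.1 ∉ matBox v (colSum z.1 u + z.2) (radius n p k)} ≤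
      ENNReal.ofReal (16 / √k + k * Real.exp (-(k / 10))) := by
    intro S hS hc
    refine prod_measure_le_of_section_le _ _ (measurableSet_noSolution n p k u S _ _) fun w => ?_
    have hdis : Disjoint u S := by
      rw [Finset.disjoint_right]
      intro j hj
      simpa using hS hj
    refine matGauss_response_forall_notMem_le hdis
      (G := {y | ∑ i, y i ^ 2 ≤ 16 * k * (2 * n + (k : ℝ) / 320)})
      (measurableSet_le (by fun_prop) measurable_const) w fun y hy => ?_
    rw [← ofReal_measureReal]
    refine ENNReal.ofReal_le_ofReal ((h.real_forall_notMem_le hc hy ha2).trans ?_)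
    have : 2 * (8 / √(k : ℝ)) = 16 / √k := by ring
    linarith
  have hpair : (matGauss n (Fin p)).prod (Measure.pi fun _ => gaussianReal 0 σsq)
      {z | ∃ v₀ ∈ (uᶜ).powersetCard k, ∃ v ∈ Finset.univ.powersetCard k, (v₀ \ v).card = k / 2 ∧
        ∑ i, (colSum z.1 u i + z.2 i - colSum z.1 v₀ i) ^ 2 ≤ n * radius n p k ^ 2 ∧
        ∑ i, (colSum z.1 v i - colSum z.1 v₀ i) ^ 2 ≤ 9 * n * radius n p k ^ 2} ≤
      ENNReal.ofReal (Real.exp (-k)) := by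
    refine prod_measure_le_of_section_le _ _ (measurableSet_exists_pair n p k u _ _) fun w => ?_
    refine (h.matGauss_exists_pair_le (by simp) u w).trans (ENNReal.ofReal_le_ofReal ?_)
    refine Real.exp_le_exp.2 ?_
    nlinarith
  have htail := prod_response_tail (n := n) hu (by omega) hσ0 hσ (k / 320)
  unfold badSet failureBound
  rw [ENNReal.ofReal_add (by positivity) (by positivity),
    ENNReal.ofReal_add (by positivity) (by positivity),
    two_mul (16 / √(k : ℝ) + k * Real.exp (-(k / 10))),
    ENNReal.ofReal_add (by positivity) (by positivity), ← add_assoc]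
  refine (measure_union_le _ _).trans (add_le_add ?_ hpair)
  refine (measure_union_le _ _).trans (add_le_add ?_ (hno S₂ h₂ hc₂))
  exact (measure_union_le _ _).trans (add_le_add htail (hno S₁ h₁ hc₁))

lemma Regime.exp_mul_choose_le {n p k : ℕ} (h : Regime n p k) {β : ℝ}
    (hβ : Real.log (p / k) / n * Real.exp (2 * k * Real.log (p / k) / n) ≤ β) :
    4 * Real.exp (k * Real.log (p / k)) * p.choose k ≤
      Real.exp (β * (3 * n * radius n p k ^ 2)) := by
  have hk := h.two_le_k'
  have hn := h.n_pos'
  have hL := h.le_log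
  have h1 : k * Real.log (p / k) * Real.exp 200 ≤ β * (n * radius n p k ^ 2) := by
    refine le_trans (le_of_eq ?_) (mul_le_mul_of_nonneg_right hβ (by positivity))
    rw [h.radius_sq]
    have h2 : Real.exp 200 = Real.exp (2 * k * Real.log (p / k) / n) *
        Real.exp (200 - 2 * (k * Real.log (p / k) / n)) := by
      rw [← Real.exp_add]
      congr 1
      ring
    rw [h2]
    field_simp
  have h3 : (4 : ℝ) ≤ Real.exp 200 := by linarith [Real.add_one_le_exp (200 : ℝ)]
  have h4 : 4 * (k * Real.log (p / k)) ≤ β * (n * radius n p k ^ 2) := by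
    refine le_trans ?_ h1
    rw [mul_comm]
    gcongr
  have h5 : (4 : ℝ) ≤ Real.exp k := by
    have h6 : (2 : ℝ) ≤ Real.exp 1 := by linarith [Real.exp_one_gt_d9]
    calc (4 : ℝ) ≤ Real.exp 1 * Real.exp 1 := by nlinarith
      _ = Real.exp 2 := by rw [← Real.exp_add]; norm_num
      _ ≤ _ := Real.exp_le_exp.2 hk
  calc _ ≤ Real.exp k * Real.exp (k * Real.log (p / k)) *
        Real.exp (k * Real.log (p / k) + k) := by
        gcongr
        exact h.choose_le' k
    _ = Real.exp (2 * k + 2 * (k * Real.log (p / k))) := by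
        rw [← Real.exp_add, ← Real.exp_add]
        congr 1
        ring
    _ ≤ _ := Real.exp_le_exp.2 (by nlinarith)

lemma Regime.dataLaw_compl_allChainsSlow_le {n p k : ℕ} (h : Regime n p k) {σsq : ℝ≥0}
    (hσ0 : σsq ≠ 0) (hσ : (σsq : ℝ) ≤ k) (hcube : k ^ 3 ≤ p) (hk : 1024 ≤ k) {β : ℝ}
    (hβ : Real.log (p / k) / n * Real.exp (2 * k * Real.log (p / k) / n) ≤ β) :
    dataLaw n p k σsq (allChainsSlow n p k β (Real.exp (k * Real.log (p / k))))ᶜ ≤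
      ENNReal.ofReal (failureBound k) := by
  have hkp : k ≤ p := (Nat.le_self_pow three_ne_zero k).trans hcube
  have hhalf : ∀ u : SparseVec p k, ∃ S : Finset (Fin p) × Finset (Fin p), S.1 ⊆ u.1ᶜ ∧
      S.2 ⊆ u.1ᶜ ∧ Disjoint S.1 S.2 ∧ S.1.card = (p - k) / 2 ∧ S.2.card = (p - k) / 2 := by
    intro u
    have hc : u.1ᶜ.card = p - k := by rw [Finset.card_compl, u.2, Fintype.card_fin]
    obtain ⟨S₁, hS₁, hc₁⟩ := Finset.exists_subset_card_eq (s := u.1ᶜ) (n := (p - k) / 2) (by omega)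
    obtain ⟨S₂, hS₂, hc₂⟩ := Finset.exists_subset_card_eq (s := u.1ᶜ \ S₁) (n := (p - k) / 2) (by
      rw [Finset.card_sdiff_of_subset hS₁, hc, hc₁]
      omega)
    exact ⟨(S₁, S₂), hS₁, hS₂.trans Finset.sdiff_subset,
      (Finset.disjoint_sdiff.mono_right hS₂), hc₁, hc₂⟩
  choose S hS₁ hS₂ hd hc₁ hc₂ using hhalf
  have hβ0 : 0 ≤ β := le_trans (by have := h.le_log; positivity) hβ
  refine (measure_mono ?_).trans (dataLaw_le hkp (fun u => badSet n p k u.1 (S u).1 (S u).2)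
    (fun u => measurableSet_badSet _ _ _ _ _ _)
    (fun u => h.measure_badSet_le hσ0 hσ hcube hk u.2 (hS₁ u) (hS₂ u) (hc₁ u) (hc₂ u)))
  intro d hd'
  by_contra hbad
  exact hd' (mem_allChainsSlow_of_notMem_badSet hβ0 (Real.exp_pos _).le (by omega)
    (h.exp_mul_choose_le hβ) d (hS₁ d.2.2) (hd d.2.2) hbad)

/-! ### The asymptotic regime -/

lemma eventually_exp_mul_factorial_le :
    ∀ᶠ k : ℕ in atTop,
      Real.exp (k / 4) * (2 * 2 ^ k * (k.factorial : ℝ)) ≤ (k : ℝ) ^ k := by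
  have hπ : √Real.pi < 2 := by
    rw [Real.sqrt_lt' (by norm_num)]
    linarith [Real.pi_lt_four]
  filter_upwards [Stirling.tendsto_stirlingSeq_sqrt_pi.eventually_lt_const hπ,
    eventually_ge_atTop 100000] with k hk hk5
  have hk0 : (0 : ℝ) < k := by
    have : (100000 : ℝ) ≤ k := by exact_mod_cast hk5
    linarith
  have hk5' : (100000 : ℝ) ≤ k := by exact_mod_cast hk5
  rw [Stirling.stirlingSeq, div_lt_iff₀ (by positivity)] at hk
  have h1 : (2 : ℝ) ^ k ≤ Real.exp (0.7 * k) := by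
    rw [mul_comm, Real.exp_nat_mul]
    gcongr
    calc (2 : ℝ) = Real.exp (Real.log 2) := (Real.exp_log (by norm_num)).symm
      _ ≤ _ := Real.exp_le_exp.2 (by linarith [Real.log_two_lt_d9])
  have h2 : 4 * √(2 * (k : ℝ)) ≤ Real.exp (0.05 * k) := by
    have h3 := Real.quadratic_le_exp_of_nonneg (by positivity : (0 : ℝ) ≤ 0.05 * k)
    have h4 : √(2 * (k : ℝ)) ≤ 2 * k := by
      rw [Real.sqrt_le_left (by positivity)]
      nlinarith
    nlinarith
  have h3 : ((k : ℝ) / Real.exp 1) ^ k = k ^ k * Real.exp (-k) := by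
    rw [div_pow, ← Real.exp_nat_mul, mul_one, Real.exp_neg, div_eq_mul_inv]
  rw [h3] at hk
  have hkk : (0 : ℝ) < (k : ℝ) ^ k := by positivity
  calc Real.exp (k / 4) * (2 * 2 ^ k * (k.factorial : ℝ))
      ≤ Real.exp (k / 4) * (2 * Real.exp (0.7 * k) *
        (2 * (√(2 * k) * (k ^ k * Real.exp (-k))))) := by gcongr
    _ = (4 * √(2 * k)) * (Real.exp (k / 4) * Real.exp (0.7 * k) * Real.exp (-k)) * k ^ k := by
        ring
    _ ≤ Real.exp (0.05 * k) * (Real.exp (k / 4) * Real.exp (0.7 * k) * Real.exp (-k)) *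
        k ^ k := by gcongr
    _ = Real.exp (0.05 * k + (k / 4 + 0.7 * k + -k)) * k ^ k := by
        rw [← Real.exp_add, ← Real.exp_add, ← Real.exp_add]
    _ ≤ 1 * k ^ k := by
        gcongr
        rw [Real.exp_le_one_iff]
        linarith
    _ = _ := one_mul _

lemma eventually_cube_le {k p : ℕ → ℕ} {η : ℝ} (hη : 0 < η) (hk : Tendsto k atTop atTop)
    (hkp : ∀ i, k i ≤ p i)
    (ho : (fun i => (k i : ℝ)) =o[atTop] fun i => (p i : ℝ) ^ ((1 / 3 : ℝ) - η)) :
    ∀ᶠ i in atTop, k i ^ 3 ≤ p i := by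
  filter_upwards [ho.bound one_pos, hk.eventually_ge_atTop 1] with i hi hk1
  have hp1 : (1 : ℝ) ≤ p i := by exact_mod_cast hk1.trans (hkp i)
  have h1 : (k i : ℝ) ≤ (p i : ℝ) ^ (1 / 3 : ℝ) := by
    rw [one_mul, Real.norm_of_nonneg (by positivity), Real.norm_of_nonneg (by positivity)] at hi
    exact hi.trans (Real.rpow_le_rpow_of_exponent_le hp1 (by linarith))
  have h2 : (k i : ℝ) ^ 3 ≤ p i := by
    calc (k i : ℝ) ^ 3 ≤ ((p i : ℝ) ^ (1 / 3 : ℝ)) ^ 3 := by gcongr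
      _ = (p i : ℝ) := by
        rw [← Real.rpow_natCast, ← Real.rpow_mul (by positivity)]
        norm_num
  exact_mod_cast h2

lemma forty_le_log {k p : ℕ} (hk : Real.exp 40 ≤ k) (hcube : k ^ 3 ≤ p) :
    40 ≤ Real.log (p / k) := by
  have hk0 : (0 : ℝ) < k := lt_of_lt_of_le (Real.exp_pos _) hk
  have hk1 : (1 : ℝ) ≤ k := le_trans (Real.one_le_exp (by norm_num)) hk
  have hcube' : (k : ℝ) ^ 3 ≤ p := by exact_mod_cast hcube
  have hp0 : (0 : ℝ) < p := lt_of_lt_of_le (by positivity) hcube'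
  rw [Real.le_log_iff_exp_le (by positivity), le_div_iff₀ hk0]
  calc Real.exp 40 * k ≤ k * k := by gcongr
    _ ≤ k * k * k := le_mul_of_one_le_right (by positivity) hk1
    _ = k ^ 3 := by ring
    _ ≤ (p : ℝ) := hcube'

end SparseRegression

end

theorem theorem4p4 :
    ∃ c > (0 : ℝ), ∃ C > (0 : ℝ), ∃ κ > (0 : ℝ), ∀ η > (0 : ℝ),
      ∀ (k n p : ℕ → ℕ) (σsq : ℕ → ℝ≥0) (β : ℕ → ℝ),
        Tendsto k atTop atTop →
        (∀ i, k i ≤ p i) →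
        (∀ i, 0 < n i) →
        (∀ i, 0 < σsq i) →
        (∀ i, (n i : ℝ) ≤ c * k i * Real.log (p i / k i)) →
        (∀ i, (σsq i : ℝ) ≤ k i) →
        ((fun i => (k i : ℝ)) =o[atTop] fun i => (p i : ℝ) ^ ((1 / 3 : ℝ) - η)) →
        (∀ i, C * (Real.log (p i / k i) / n i * Real.exp (2 * k i * Real.log (p i / k i) / n i))
          < β i) →
        Tendsto (fun i => SparseRegression.dataLaw (n i) (p i) (k i) (σsq i)
            (SparseRegression.allChainsSlow (n i) (p i) (k i) (β i)
              (Real.exp (κ * k i * Real.log (p i / k i))))ᶜ)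
          atTop (𝓝 0) := by
  refine ⟨1 / 2000, by norm_num, 1, one_pos, 1, one_pos, ?_⟩
  intro η hη k n p σsq β hk hkp hn hσ0 hnk hσ ho hβ
  have hlim : Tendsto (fun i => ENNReal.ofReal (SparseRegression.failureBound (k i))) atTop (𝓝 0) := by
    have h := ENNReal.tendsto_ofReal (SparseRegression.tendsto_failureBound.comp hk)
    rwa [ENNReal.ofReal_zero] at h
  refine tendsto_of_tendsto_of_tendsto_of_le_of_le' tendsto_const_nhds hlim
    (Eventually.of_forall fun _ => zero_le) ?_
  filter_upwards [SparseRegression.eventually_cube_le hη hk hkp ho,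
    hk.eventually SparseRegression.eventually_exp_mul_factorial_le,
    hk.eventually_ge_atTop 1024,
    (tendsto_natCast_atTop_atTop.comp hk).eventually_ge_atTop (Real.exp 40)]
    with i hcube hfact hk1 hk40
  have hreg : SparseRegression.Regime (n i) (p i) (k i) :=
    { n_pos := hn i
      two_le_k := by omega
      sq_le := by
        refine le_trans ?_ hcube
        calc 16 * k i ^ 2 ≤ k i * k i ^ 2 := Nat.mul_le_mul_right _ (by omega)
          _ = k i ^ 3 := by ring
      n_le := by
        have := hnk i
        linarith
      le_log := SparseRegression.forty_le_log hk40 hcube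
      factorial_le := hfact }
  have hβi := hβ i
  rw [one_mul] at hβi ⊢
  exact hreg.dataLaw_compl_allChainsSlow_le (hσ0 i).ne' (hσ i) hcube hk1 hβi.le
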